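/- Let $\mathbb{R}^{2,1}$ be $\mathbb{R}^3$ with the inner product $\langle v,w\rangle=-v^0w^0+v^1w^1+v^2w^2$; a Minkowski isometry is a map $x\mapsto Ax+b$ with $A\in O(2,1)$. Let $\Sigma\subset\mathbb{R}^{2,1}$ be a connected, smooth regular surface which is lightlike (the inner product is degenerate on every tangent plane). A local $0$-adapted frame on $\Sigma$ is a smooth frame $(e_0,e_1,e_2)$ with $T\Sigma=\mathrm{span}(e_0,e_1)$, $\langle e_0,e_0\rangle=\langle e_0,e_1\rangle=\langle e_1,e_2\rangle=\langle e_2,e_2\rangle=0$ and $\langle e_0,e_2\rangle=\langle e_1,e_1\rangle=1$; its forms $\omega^\alpha,\omega^\alpha_\beta$ are defined by $dx=\sum_\alpha e_\alpha\omega^\alpha$ and $de_\beta=\sum_\alpha e_\alpha\omega^\alpha_\beta$. Define $a_1$ by $\omega^1_0=a_1\omega^1$ and, for frames with $a_1\equiv1$ (called $1$-adapted), $a_2$ by $\omega^0_0-\omega^0=a_2\omega^1$. Call $\Sigma$ of constant type if either $a_1\equiv0$ (for all $0$-adapted frames), or $a_1$ vanishes nowhere and (for all $1$-adapted frames) $a_2$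 is either identically zero or nowhere zero; call it non-conical if $a_1$ and $a_2$ vanish nowhere. If $\Sigma$ is of constant type, then $\Sigma$ is contained in a lightlike plane; or $\Sigma$ is contained in a light cone $\{x:\langle x-p,x-p\rangle=0\}$; or for every point $P\in\Sigma$ there are a Minkowski isometry $\varphi$, an open interval $I\ni0$, a smooth function $f:I\to\mathbb{R}$ and $u_0\in\mathbb{R}$ such that, on some open neighbourhood of $(u_0,0)$ in $\mathbb{R}\times I$, $$x(u,v)=e^uG_0(v)-\int_0^vG_0(\tau)\,d\tau-G_0(0)$$ is a local parametrization of $\varphi(\Sigma)$ with $x(u_0,0)=\varphi(P)$. Here $G_0:I\to\mathbb{R}^{2,1}$ is the unique solution of $G_0'''-2fG_0'-f'G_0=0$ with $$G_0(0)=\tfrac1{\sqrt2}\begin{bmatrix}1\\1\\0\end{bmatrix},\quad G_0'(0)=\begin{bmatrix}\tfrac1{\sqrt2}\\\tfrac1{\sqrt2}\\1\end{bmatrix},\quad G_0''(0)=\begin{bmatrix}\tfrac1{\sqrt2}(f(0)+\tfrac32)\\\tfrac1{\sqrt2}(f(0)-\tfrac12)\\1\end{bmatrix}.$$ Every non-conical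 lightlike regular surface (connected or not) is of this third kind. Conversely $f$ is arbitrary: for every smooth $f$ on an open interval $I\ni0$ the solution $G_0$ exists on $I$ and is unique, and every point of $\mathbb{R}\times I$ has an open neighbourhood $W\subset\mathbb{R}\times I$ such that $x(W)$ is a non-conical lightlike regular surface with $x|_W$ as a parametrization. -/

import Mathlib

open scoped ContDiff Matrix

namespace LightlikeSurface

/-- Points and tangent vectors of `ℝ^{2,1}`, with coordinates `(x⁰, x¹, x²)`. -/
abbrev Mink : Type := Fin 3 → ℝ

/-- The Minkowski inner product `⟨v, w⟩ = -v⁰w⁰ + v¹w¹ + v²w²`. -/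
def inn (v w : Mink) : ℝ := -(v 0 * w 0) + v 1 * w 1 + v 2 * w 2

/-- Minkowski isometries: `φ(x) = A x + b` with `A ∈ O(2,1)`. -/
def IsMinkowskiIsometry (φ : Mink → Mink) : Prop :=
  ∃ (A : Matrix (Fin 3) (Fin 3) ℝ) (b : Mink),
    (∀ v w : Mink, inn (A *ᵥ v) (A *ᵥ w) = inn v w) ∧ ∀ x, φ x = A *ᵥ x + b

/-- The restriction of the Minkowski inner product to the subspace `V` is degenerate. -/
def IsDegenerate (V : Submodule ℝ Mink) : Prop :=
  ∃ v ∈ V, v ≠ 0 ∧ ∀ w ∈ V, inn v w = 0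

/-! ### Regular surfaces -/

/-- `X` restricted to the open set `U ⊆ ℝ²` is a local parametrization of `S ⊆ ℝ^{2,1}`: it is a
smooth immersion and a homeomorphism of `U` onto a relatively open subset of `S`. -/
structure IsLocalParam (S : Set Mink) (U : Set (ℝ × ℝ)) (X : ℝ × ℝ → Mink) : Prop where
  isOpen : IsOpen U
  smooth : ContDiffOn ℝ ∞ X U
  immersion : ∀ q ∈ U, Function.Injective (fderiv ℝ X q)
  mapsTo : Set.MapsTo X U S
  isOpenEmbedding : Topology.IsOpenEmbedding (mapsTo.restrict X U S)

/-- `S` is a (smooth, embedded) regular surface. -/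
def IsRegularSurface (S : Set Mink) : Prop :=
  ∀ p ∈ S, ∃ (U : Set (ℝ × ℝ)) (X : ℝ × ℝ → Mink), IsLocalParam S U X ∧ p ∈ X '' U

/-- The tangent plane at the point `X q` of a surface with local parametrization `X`. -/
noncomputable def tangentPlane (X : ℝ × ℝ → Mink) (q : ℝ × ℝ) : Submodule ℝ Mink :=
  LinearMap.range (fderiv ℝ X q : ℝ × ℝ →ₗ[ℝ] Mink)

/-- Every tangent plane of the surface `S` is lightlike. -/
def IsLightlike (S : Set Mink) : Prop :=
  ∀ (U : Set (ℝ × ℝ)) (X : ℝ × ℝ → Mink), IsLocalParam S U X →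
    ∀ q ∈ U, IsDegenerate (tangentPlane X q)

/-! ### Adapted frames, Maurer-Cartan forms and the invariants `a₁`, `a₂` -/

/-- `E = (e₀, e₁, e₂)` is a 0-adapted frame along the local parametrization `X` on `U`. -/
structure IsZeroAdapted (U : Set (ℝ × ℝ)) (X : ℝ × ℝ → Mink)
    (E : Fin 3 → ℝ × ℝ → Mink) : Prop where
  smooth : ∀ α, ContDiffOn ℝ ∞ (E α) U
  span_eq : ∀ q ∈ U, Submodule.span ℝ {E 0 q, E 1 q} = tangentPlane X q
  inn_zero_zero : ∀ q ∈ U, inn (E 0 q) (E 0 q) = 0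
  inn_zero_one : ∀ q ∈ U, inn (E 0 q) (E 1 q) = 0
  inn_one_two : ∀ q ∈ U, inn (E 1 q) (E 2 q) = 0
  inn_two_two : ∀ q ∈ U, inn (E 2 q) (E 2 q) = 0
  inn_zero_two : ∀ q ∈ U, inn (E 0 q) (E 2 q) = 1
  inn_one_one : ∀ q ∈ U, inn (E 1 q) (E 1 q) = 1

/-- `η α = ω^α` and `Θ α β = ω^α_β` are the values at `q` of the dual and connection forms of the
frame `E` along `X`: `dx = e_α ω^α` and `de_β = e_α ω^α_β`. -/
structure IsMaurerCartanAt (X : ℝ × ℝ → Mink) (E : Fin 3 → ℝ × ℝ → Mink) (q : ℝ × ℝ)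
    (η : Fin 3 → (ℝ × ℝ →L[ℝ] ℝ)) (Θ : Fin 3 → Fin 3 → (ℝ × ℝ →L[ℝ] ℝ)) : Prop where
  dx : ∀ w, fderiv ℝ X q w = ∑ α, η α w • E α q
  de : ∀ β w, fderiv ℝ (E β) q w = ∑ α, Θ α β w • E α q

/-- The function `a₁` of the 0-adapted frame `E`, defined by `ω^1_0 = a₁ ω^1`, has the value `a`
at `q`. -/
def HasA1 (X : ℝ × ℝ → Mink) (E : Fin 3 → ℝ × ℝ → Mink) (q : ℝ × ℝ) (a : ℝ) : Prop :=
  ∃ η Θ, IsMaurerCartanAt X E q η Θ ∧ Θ 1 0 = a • η 1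

/-- A 1-adapted frame: a 0-adapted frame with `a₁ ≡ 1`. -/
def IsOneAdapted (U : Set (ℝ × ℝ)) (X : ℝ × ℝ → Mink) (E : Fin 3 → ℝ × ℝ → Mink) : Prop :=
  IsZeroAdapted U X E ∧ ∀ q ∈ U, HasA1 X E q 1

/-- The function `a₂` of the 1-adapted frame `E`, defined by `ω^0_0 - ω^0 = a₂ ω^1`, has the value
`a` at `q`. -/
def HasA2 (X : ℝ × ℝ → Mink) (E : Fin 3 → ℝ × ℝ → Mink) (q : ℝ × ℝ) (a : ℝ) : Prop :=
  ∃ η Θ, IsMaurerCartanAt X E q η Θ ∧ Θ 0 0 - η 0 = a • η 1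

/-- `a₁ ≡ 0` for every 0-adapted frame on `S`. -/
def A1Zero (S : Set Mink) : Prop :=
  ∀ U X E, IsLocalParam S U X → IsZeroAdapted U X E → ∀ q ∈ U, HasA1 X E q 0

/-- `a₁` is nowhere zero for every 0-adapted frame on `S`. -/
def A1NeZero (S : Set Mink) : Prop :=
  ∀ U X E, IsLocalParam S U X → IsZeroAdapted U X E → ∀ q ∈ U, ∃ a, a ≠ 0 ∧ HasA1 X E q a

/-- `a₂ ≡ 0` for every 1-adapted frame on `S`. -/
def A2Zero (S : Set Mink) : Prop :=
  ∀ U X E, IsLocalParam S U X → IsOneAdapted U X E → ∀ q ∈ U, HasA2 X E q 0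

/-- `a₂` is nowhere zero for every 1-adapted frame on `S`. -/
def A2NeZero (S : Set Mink) : Prop :=
  ∀ U X E, IsLocalParam S U X → IsOneAdapted U X E → ∀ q ∈ U, ∃ a, a ≠ 0 ∧ HasA2 X E q a

/-- A lightlike surface is non-conical if neither `a₁` nor `a₂` vanishes anywhere. -/
def IsNonConical (S : Set Mink) : Prop := A1NeZero S ∧ A2NeZero S

/-- A lightlike surface is of constant type if `a₁` is identically zero or nowhere zero and, in the
latter case, `a₂` is identically zero or nowhere zero. -/
def IsConstantType (S : Set Mink) : Prop :=
  A1Zero S ∨ (A1NeZero S ∧ (A2Zero S ∨ A2NeZero S))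

/-! ### The three cases -/

/-- `S` is contained in a lightlike (affine) plane. -/
def InLightlikePlane (S : Set Mink) : Prop :=
  ∃ (p : Mink) (V : Submodule ℝ Mink), Module.finrank ℝ V = 2 ∧ IsDegenerate V ∧
    ∀ x ∈ S, x - p ∈ V

/-- `S` is contained in the light cone based at some point. -/
def InLightCone (S : Set Mink) : Prop :=
  ∃ p : Mink, ∀ x ∈ S, inn (x - p) (x - p) = 0

/-- `G` solves, on `I`, the equation `G''' - 2 f G' - f' G = 0` with the prescribed initial
conditions at `0`. -/
structure IsSolution (I : Set ℝ) (f : ℝ → ℝ) (G : ℝ → Mink) : Prop where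
  contDiffOn : ContDiffOn ℝ 3 G I
  ode : ∀ v ∈ I, iteratedDeriv 3 G v - (2 * f v) • deriv G v - deriv f v • G v = 0
  init_zero : G 0 = ![1 / √2, 1 / √2, 0]
  init_one : deriv G 0 = ![1 / √2, 1 / √2, 1]
  init_two : iteratedDeriv 2 G 0 = ![(1 / √2) * (f 0 + 3 / 2), (1 / √2) * (f 0 - 1 / 2), 1]

/-- `G` is the unique solution on `I` of this initial value problem. -/
def IsUniqueSolution (I : Set ℝ) (f : ℝ → ℝ) (G : ℝ → Mink) : Prop :=
  IsSolution I f G ∧ ∀ H, IsSolution I f H → Set.EqOn H G I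

/-- `f` is a smooth function on the open interval `I` (possibly unbounded) containing `0`. -/
def IsProfile (I : Set ℝ) (f : ℝ → ℝ) : Prop :=
  IsOpen I ∧ I.OrdConnected ∧ (0 : ℝ) ∈ I ∧ ContDiffOn ℝ ∞ f I

/-- The map `x(u, v) = e^u G(v) - ∫₀^v G(τ) dτ - G(0)`. -/
noncomputable def normalForm (G : ℝ → Mink) (q : ℝ × ℝ) : Mink :=
  Real.exp q.1 • G q.2 - (∫ τ in (0 : ℝ)..q.2, G τ) - G 0

/-- Near each of its points, `S` is parametrized, up to a Minkowski isometry, by the normal form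
`x(u, v)` of some profile `f`; the point has coordinate `v = 0`. -/
def LocallyNormalForm (S : Set Mink) : Prop :=
  ∀ p ∈ S, ∃ φ : Mink → Mink, IsMinkowskiIsometry φ ∧
    ∃ (I : Set ℝ) (f : ℝ → ℝ) (G : ℝ → Mink), IsProfile I f ∧ IsUniqueSolution I f G ∧
      ∃ (W : Set (ℝ × ℝ)) (u₀ : ℝ), (∀ q ∈ W, q.2 ∈ I) ∧
        IsLocalParam (φ '' S) W (normalForm G) ∧
        (u₀, (0 : ℝ)) ∈ W ∧ normalForm G (u₀, 0) = φ p

end LightlikeSurface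

namespace LightlikeSurface

/-! ### The smooth inverse function theorem and linear differential equations -/

/-! A lightlike plane is the orthogonal complement of a null line that it contains, so `e₀` is both
tangent and normal to the surface and is intrinsic up to a factor. Since `⟨e₀, dx⟩ = 0` and `⟨e₀,
de₀⟩ = 0`, the structure equations say `de₀ ≡ a₁ dx` modulo `e₀` (`IsZeroAdapted.hasA1_iff`).
Replacing `e₀` by `λ e₀` multiplies `a₁` by `λ`, so the vanishing of `a₁` is intrinsic, and where
`a₁ ≠ 0` the condition `a₁ = 1` singles out one vector field `e₀`.

If `a₁ = 0`, the direction `n` of `e₀` is locally constant and so is `⟨x, n⟩`; connectedness yields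
a lightlike plane. If `a₁ = 1`, then `Z = e₀ - x` satisfies `dZ = a₂ ω¹ e₀`. When `a₂ = 0`, `Z` is a
constant `-p` and `x - p = e₀` is null, a light cone. When `a₂ ≠ 0`, `Z` has rank one and its image
is a null curve `z` tangent to `e₀`, so `x = s n(τ) - z(τ)` with `z' = n` null
(`exists_ruled_form`). A reparametrization replaces `n` by a null curve `G` with `⟨G', G'⟩ = 1` and
`z` by a primitive of `G` (`exists_ruled_nullCurve`).

For such `G`, the Gram matrix of `(G, G', G'')` depends only on `f = -⟨G'', G''⟩ / 2`.
Differentiating its entries gives the third-order equation (`IsNullCurve.ode`), and equality of Gram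
matrices provides the isometry that moves the values at `0` to the prescribed ones
(`IsGram.exists_isometry`).

Conversely, the third-order equation is the symmetric square of `y'' = (f / 2) y`: quadratic
expressions in two solutions with Wronskian `1` give a null curve with the required data
(`exists_solution`), and the invariants of its ruled surface can be computed directly
(`IsNullCurve.isNonConical_image`). -/

theorem exists_smooth_inverse {E : Type*} [NormedAddCommGroup E] [NormedSpace ℝ E]
    [FiniteDimensional ℝ E] {f : E → E} {U : Set E} (hU : IsOpen U) (hf : ContDiffOn ℝ ∞ f U)
    {a : E} (ha : a ∈ U) (hinj : Function.Injective (fderiv ℝ f a)) :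
    ∃ e : OpenPartialHomeomorph E E, a ∈ e.source ∧ e.source ⊆ U ∧ (∀ x, e x = f x) ∧
      ContDiffOn ℝ ∞ e.symm e.target := by
  have : CompleteSpace E := FiniteDimensional.complete ℝ E
  have hfa : ContDiffAt ℝ ∞ f a := hf.contDiffAt (hU.mem_nhds ha)
  have hequiv : ∀ L : E →L[ℝ] E, Function.Injective L → ∃ L' : E ≃L[ℝ] E, (L' : E →L[ℝ] E) = L := by
    intro L hL
    refine ⟨(LinearEquiv.ofInjectiveEndo (L : E →ₗ[ℝ] E) hL).toContinuousLinearEquiv, ?_⟩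
    ext x
    rfl
  obtain ⟨f', hf'⟩ := hequiv _ hinj
  have hd : HasFDerivAt f (f' : E →L[ℝ] E) a := by
    rw [hf']; exact (hfa.differentiableAt (by simp)).hasFDerivAt
  let e₀ := hfa.toOpenPartialHomeomorph f hd (by simp)
  -- Restricting to the open set where the derivative stays invertible makes the inverse smooth on
  -- its whole target, not only at the image of `a`.
  let O : Set E := U ∩ fderiv ℝ f ⁻¹' Set.range ((↑) : (E ≃L[ℝ] E) → E →L[ℝ] E)
  have hO : IsOpen O :=
    (hf.continuousOn_fderiv_of_isOpen hU (by simp)).isOpen_inter_preimage hU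
      (ContinuousLinearEquiv.isOpen)
  refine ⟨e₀.restrOpen O hO, ⟨hfa.mem_toOpenPartialHomeomorph_source hd (by simp), ha, f', hf'⟩,
    fun x hx => hx.2.1, fun x => rfl, ?_⟩
  intro y hy
  have hs := (e₀.restrOpen O hO).map_target hy
  obtain ⟨-, hxU, g', hg'⟩ := hs
  have hfx : ContDiffAt ℝ ∞ f _ := hf.contDiffAt (hU.mem_nhds hxU)
  refine ((e₀.restrOpen O hO).contDiffAt_symm (f₀' := g') hy ?_ ?_).contDiffWithinAt
  · rw [hg']; exact (hfx.differentiableAt (by simp)).hasFDerivAt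
  · exact hfx

/-! ### Existence, uniqueness and smoothness for linear differential equations. -/

section LinearODE

variable {E : Type*} [NormedAddCommGroup E] [NormedSpace ℝ E]

/-- The weight `cosh (M t)` reproduces itself under integration with a gain of `1 / M`, because
`|sinh| < cosh`. This is what makes the Picard map below contract. -/
theorem abs_integral_cosh_le {M : ℝ} (hM : 0 < M) (c t : ℝ) (hc : 0 ≤ c) :
    |∫ s in (0 : ℝ)..t, c * Real.cosh (M * s)| ≤ c / M * Real.cosh (M * t) := by
  have hd : ∀ s ∈ Set.uIcc 0 t,
      HasDerivAt (fun s => c / M * Real.sinh (M * s)) (c * Real.cosh (M * s)) s := by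
    intro s _
    have h := ((((hasDerivAt_id s).const_mul M).sinh).const_mul (c / M))
    refine h.congr_deriv ?_
    field_simp
    simp
  rw [intervalIntegral.integral_eq_sub_of_hasDerivAt hd
    (Continuous.intervalIntegrable (by fun_prop) _ _)]
  simp only [mul_zero, Real.sinh_zero, sub_zero, abs_mul, abs_of_nonneg (div_nonneg hc hM.le)]
  refine mul_le_mul_of_nonneg_left ?_ (div_nonneg hc hM.le)
  rw [Real.abs_sinh, ← Real.cosh_abs]
  exact (Real.sinh_lt_cosh _).le

/-- Picard iteration in a weighted norm: with `Y = cosh (M t) Z` and `Z` bounded, the integral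
equation becomes a fixed-point problem for `Z` on the whole line, with Lipschitz constant `K / M ≤ 1
/ 2`. -/
theorem exists_linear_ode_of_bounded [CompleteSpace E] {A : ℝ → E →L[ℝ] E} (hA : Continuous A) {K : ℝ}
    (hK : ∀ t, ‖A t‖ ≤ K) (y₀ : E) :
    ∃ Y : ℝ → E, Y 0 = y₀ ∧ ∀ t, HasDerivAt Y (A t (Y t)) t := by
  have hK0 : 0 ≤ K := (norm_nonneg _).trans (hK 0)
  set M : ℝ := 2 * (K + 1)
  have hM : 0 < M := by positivity
  have hcont : ∀ Z : BoundedContinuousFunction ℝ E,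
      Continuous fun s => Real.cosh (M * s) • A s (Z s) := fun Z => by
    have := Z.continuous
    fun_prop
  have hbound : ∀ Z : BoundedContinuousFunction ℝ E, ∀ t,
      ‖(Real.cosh (M * t))⁻¹ • ∫ s in (0 : ℝ)..t, Real.cosh (M * s) • A s (Z s)‖
        ≤ K / M * ‖Z‖ := by
    intro Z t
    have hc := Real.cosh_pos (M * t)
    have h1 : ‖∫ s in (0 : ℝ)..t, Real.cosh (M * s) • A s (Z s)‖
        ≤ |∫ s in (0 : ℝ)..t, (K * ‖Z‖) * Real.cosh (M * s)| := by
      refine intervalIntegral.norm_integral_le_abs_of_norm_le ?_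
        (Continuous.intervalIntegrable (by fun_prop) _ _)
      refine Filter.Eventually.of_forall fun s => ?_
      rw [norm_smul, Real.norm_of_nonneg (Real.cosh_pos _).le, mul_comm]
      refine mul_le_mul_of_nonneg_right ?_ (Real.cosh_pos _).le
      exact ((A s).le_opNorm _).trans (mul_le_mul (hK s) (Z.norm_coe_le_norm s) (norm_nonneg _) hK0)
    have h2 := abs_integral_cosh_le hM (K * ‖Z‖) t (by positivity)
    rw [norm_smul, norm_inv, Real.norm_of_nonneg hc.le, inv_mul_le_iff₀ hc]
    refine (h1.trans h2).trans (le_of_eq ?_)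
    ring
  let T : BoundedContinuousFunction ℝ E → BoundedContinuousFunction ℝ E := fun Z =>
    BoundedContinuousFunction.ofNormedAddCommGroup
      (fun t => (Real.cosh (M * t))⁻¹ • y₀ +
        (Real.cosh (M * t))⁻¹ • ∫ s in (0 : ℝ)..t, Real.cosh (M * s) • A s (Z s))
      (by
        have h := intervalIntegral.continuous_primitive (μ := MeasureTheory.volume)
          (fun a b => (hcont Z).intervalIntegrable a b) 0
        have h' : Continuous fun t => (Real.cosh (M * t))⁻¹ :=
          Continuous.inv₀ (by fun_prop) fun t => (Real.cosh_pos _).ne'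
        fun_prop)
      (‖y₀‖ + K / M * ‖Z‖)
      (by
        intro t
        refine (norm_add_le _ _).trans (add_le_add ?_ (hbound Z t))
        rw [norm_smul, norm_inv, Real.norm_of_nonneg (Real.cosh_pos _).le]
        exact mul_le_of_le_one_left (norm_nonneg _) (inv_le_one_of_one_le₀ (Real.one_le_cosh _)))
  have hTapp : ∀ Z t, T Z t = (Real.cosh (M * t))⁻¹ • y₀ +
        (Real.cosh (M * t))⁻¹ • ∫ s in (0 : ℝ)..t, Real.cosh (M * s) • A s (Z s) := fun _ _ => rfl
  have hT : ContractingWith (1 / 2) T := by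
    refine ⟨by rw [← NNReal.coe_lt_coe]; norm_num, LipschitzWith.of_dist_le_mul fun Z Z' => ?_⟩
    rw [BoundedContinuousFunction.dist_le (by positivity)]
    intro t
    have h := hbound (Z - Z') t
    have h1 : T Z t - T Z' t = (Real.cosh (M * t))⁻¹ •
        ∫ s in (0 : ℝ)..t, Real.cosh (M * s) • A s ((Z - Z') s) := by
      rw [hTapp, hTapp, add_sub_add_left_eq_sub, ← smul_sub, ← intervalIntegral.integral_sub
        ((hcont Z).intervalIntegrable _ _) ((hcont Z').intervalIntegrable _ _)]
      simp [smul_sub]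
    rw [dist_eq_norm, h1, dist_eq_norm]
    refine h.trans (mul_le_mul_of_nonneg_right ?_ (norm_nonneg _))
    rw [div_le_iff₀ hM]
    simp [M]
  obtain ⟨Z, hZ⟩ : ∃ Z, T Z = Z := ⟨_, hT.fixedPoint_isFixedPt⟩
  have hY : ∀ t, Real.cosh (M * t) • Z t =
      y₀ + ∫ s in (0 : ℝ)..t, A s (Real.cosh (M * s) • Z s) := by
    intro t
    conv_lhs => rw [← hZ, hTapp, ← smul_add, smul_inv_smul₀ (Real.cosh_pos _).ne']
    simp
  refine ⟨fun t => Real.cosh (M * t) • Z t, by simpa using hY 0, fun t => ?_⟩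
  have hc : Continuous fun s => A s (Real.cosh (M * s) • Z s) := by simpa using hcont Z
  have := (intervalIntegral.integral_hasDerivAt_right (hc.intervalIntegrable 0 t)
    hc.aestronglyMeasurable.stronglyMeasurableAtFilter hc.continuousAt).const_add y₀
  exact this.congr_of_eventuallyEq (Filter.Eventually.of_forall hY)

theorem exists_Icc_subset_of_mem {I : Set ℝ} (hI : IsOpen I) (hc : I.OrdConnected) {s t : ℝ}
    (hs : s ∈ I) (ht : t ∈ I) :
    ∃ a b, s ∈ Set.Ioo a b ∧ t ∈ Set.Ioo a b ∧ Set.Icc a b ⊆ I := by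
  have hex : ∀ r ∈ I, ∃ a b, r ∈ Set.Ioo a b ∧ a ∈ I ∧ b ∈ I := by
    intro r hr
    obtain ⟨ε, hε, h⟩ := Metric.isOpen_iff.1 hI r hr
    refine ⟨r - ε / 2, r + ε / 2, ⟨by linarith, by linarith⟩, h ?_, h ?_⟩ <;>
      simp [abs_of_pos hε, hε]
  obtain ⟨a, b, h, ha, hb⟩ := hex s hs
  obtain ⟨a', b', h', ha', hb'⟩ := hex t ht
  refine ⟨min a a', max b b', ⟨?_, ?_⟩, ⟨?_, ?_⟩, hc.out ?_ ?_⟩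
  · exact (min_le_left _ _).trans_lt h.1
  · exact h.2.trans_le (le_max_left _ _)
  · exact (min_le_right _ _).trans_lt h'.1
  · exact h'.2.trans_le (le_max_right _ _)
  · rcases min_choice a a' with h | h <;> rwa [h]
  · rcases max_choice b b' with h | h <;> rwa [h]

theorem linear_ode_unique {I : Set ℝ} (hI : IsOpen I) (hc : I.OrdConnected) {A : ℝ → E →L[ℝ] E}
    (hA : ContinuousOn A I) {Y Z : ℝ → E} (hY : ∀ t ∈ I, HasDerivAt Y (A t (Y t)) t)
    (hZ : ∀ t ∈ I, HasDerivAt Z (A t (Z t)) t) {t₀ : ℝ} (h₀ : t₀ ∈ I) (h : Y t₀ = Z t₀) :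
    Set.EqOn Y Z I := by
  intro t ht
  obtain ⟨a, b, hs, ht, hab⟩ := exists_Icc_subset_of_mem hI hc h₀ ht
  obtain ⟨K, hK⟩ := isCompact_Icc.exists_bound_of_continuousOn (hA.mono hab)
  have hsub := Set.Ioo_subset_Icc_self.trans hab
  refine ODE_solution_unique_of_mem_Icc (v := fun t x => A t x) (s := fun _ => Set.univ)
    (K := K.toNNReal) (a := a) (b := b) ?_ hs ?_ (fun t ht => hY t (hsub ht)) (fun _ _ => trivial)
    ?_ (fun t ht => hZ t (hsub ht)) (fun _ _ => trivial) h (Set.Ioo_subset_Icc_self ht)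
  · intro t ht
    refine ((A t).lipschitz.weaken ?_).lipschitzOnWith
    rw [← norm_toNNReal]
    exact Real.toNNReal_le_toNNReal (hK t (Set.Ioo_subset_Icc_self ht))
  · exact fun t ht => (hY t (hab ht)).continuousAt.continuousWithinAt
  · exact fun t ht => (hZ t (hab ht)).continuousAt.continuousWithinAt

/-- The coefficient is bounded on compact subintervals. Freezing it at the endpoints outside such an
interval reduces to the bounded case, and uniqueness glues the resulting solutions. -/
theorem exists_linear_ode [CompleteSpace E] {I : Set ℝ} (hI : IsOpen I) (hc : I.OrdConnected)
    {A : ℝ → E →L[ℝ] E} (hA : ContinuousOn A I) (h₀ : (0 : ℝ) ∈ I) (y₀ : E) :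
    ∃ Y : ℝ → E, Y 0 = y₀ ∧ ∀ t ∈ I, HasDerivAt Y (A t (Y t)) t := by
  have hloc : ∀ a b, (0 : ℝ) ∈ Set.Ioo a b → Set.Icc a b ⊆ I →
      ∃ Y : ℝ → E, Y 0 = y₀ ∧ ∀ t ∈ Set.Ioo a b, HasDerivAt Y (A t (Y t)) t := by
    intro a b h0 hab
    have hle : a ≤ b := h0.1.le.trans h0.2.le
    obtain ⟨K, hK⟩ := isCompact_Icc.exists_bound_of_continuousOn (hA.mono hab)
    obtain ⟨Y, hY0, hY⟩ := exists_linear_ode_of_bounded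
      (A := fun t => A (Set.projIcc a b hle t))
      (hA.comp_continuous (by fun_prop) fun t => hab (Set.projIcc a b hle t).2)
      (K := K) (fun t => hK _ (Set.projIcc a b hle t).2) y₀
    refine ⟨Y, hY0, fun t ht => ?_⟩
    have := hY t
    rwa [Set.projIcc_of_mem hle (Set.Ioo_subset_Icc_self ht)] at this
  choose! a b hab using fun t (ht : t ∈ I) => exists_Icc_subset_of_mem hI hc h₀ ht
  choose! Y hY using fun t (ht : t ∈ I) => hloc (a t) (b t) (hab t ht).1 (hab t ht).2.2
  -- The value at `t` is read from the solution attached to an interval containing both `0` and `t`.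
  -- Near `t₀` all these solutions agree with `Y t₀`.
  refine ⟨fun t => Y t t, (hY 0 h₀).1, fun t₀ ht₀ => ?_⟩
  have heq : Set.EqOn (fun t => Y t t) (Y t₀) (Set.Ioo (a t₀) (b t₀)) := by
    intro t ht
    have htI : t ∈ I := (hab t₀ ht₀).2.2 (Set.Ioo_subset_Icc_self ht)
    refine linear_ode_unique (I := Set.Ioo (a t) (b t) ∩ Set.Ioo (a t₀) (b t₀))
      (isOpen_Ioo.inter isOpen_Ioo) (Set.ordConnected_Ioo.inter Set.ordConnected_Ioo) (A := A)
      (hA.mono fun s hs => (hab t₀ ht₀).2.2 (Set.Ioo_subset_Icc_self hs.2))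
      (fun s hs => (hY t htI).2 s hs.1) (fun s hs => (hY t₀ ht₀).2 s hs.2)
      (t₀ := 0) ⟨(hab t htI).1, (hab t₀ ht₀).1⟩ ?_ ⟨(hab t htI).2.1, ht⟩
    rw [(hY t htI).1, (hY t₀ ht₀).1]
  have hev : (fun t => Y t t) =ᶠ[nhds t₀] Y t₀ :=
    heq.eventuallyEq_of_mem (isOpen_Ioo.mem_nhds (hab t₀ ht₀).2.1)
  exact ((hY t₀ ht₀).2 t₀ (hab t₀ ht₀).2.1).congr_of_eventuallyEq hev

theorem contDiffOn_of_linear_ode {I : Set ℝ} (hI : IsOpen I) {A : ℝ → E →L[ℝ] E}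
    (hA : ContDiffOn ℝ ∞ A I) {Y : ℝ → E} (hY : ∀ t ∈ I, HasDerivAt Y (A t (Y t)) t) :
    ContDiffOn ℝ ∞ Y I := by
  rw [contDiffOn_infty]
  intro n
  induction n with
  | zero => exact contDiffOn_zero.2 fun t ht => (hY t ht).continuousAt.continuousWithinAt
  | succ n ih =>
    rw [Nat.cast_succ, contDiffOn_succ_iff_deriv_of_isOpen hI]
    refine ⟨fun t ht => (hY t ht).differentiableAt.differentiableWithinAt, by simp, ?_⟩
    refine ContDiffOn.congr ?_ fun t ht => (hY t ht).deriv
    exact (contDiffOn_infty.1 hA n).clm_apply ih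

end LinearODE

/-! ### The Minkowski inner product -/

theorem inn_comm (v w : Mink) : inn v w = inn w v := by simp only [inn]; ring

theorem inn_add_left (u v w : Mink) : inn (u + v) w = inn u w + inn v w := by
  simp only [inn, Pi.add_apply]; ring

theorem inn_add_right (u v w : Mink) : inn u (v + w) = inn u v + inn u w := by
  simp only [inn, Pi.add_apply]; ring

theorem inn_sub_left (u v w : Mink) : inn (u - v) w = inn u w - inn v w := by
  simp only [inn, Pi.sub_apply]; ring

theorem inn_sub_right (u v w : Mink) : inn u (v - w) = inn u v - inn u w := by
  simp only [inn, Pi.sub_apply]; ring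

theorem inn_smul_left (c : ℝ) (v w : Mink) : inn (c • v) w = c * inn v w := by
  simp only [inn, Pi.smul_apply, smul_eq_mul]; ring

theorem inn_smul_right (c : ℝ) (v w : Mink) : inn v (c • w) = c * inn v w := by
  simp only [inn, Pi.smul_apply, smul_eq_mul]; ring

theorem inn_zero_left (w : Mink) : inn 0 w = 0 := by simp [inn]

theorem inn_zero_right (w : Mink) : inn w 0 = 0 := by simp [inn]

theorem time_ne_zero_of_null {v : Mink} (hv : inn v v = 0) (h : v ≠ 0) : v 0 ≠ 0 := by
  intro h0
  simp only [inn, h0] at hv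
  apply h
  ext i
  fin_cases i
  · exact h0
  · simp only [Fin.mk_one, Pi.zero_apply]; nlinarith [sq_nonneg (v 1), sq_nonneg (v 2)]
  · simp only [Fin.reduceFinMk, Pi.zero_apply]; nlinarith [sq_nonneg (v 1), sq_nonneg (v 2)]

/-- A form of signature `(2, 1)` has no totally null plane. Combining the three relations eliminates
the inner products and leaves a sum of two squares of minors equal to zero. -/
theorem eq_smul_of_null {v w : Mink} (hv : inn v v = 0) (hw : inn w w = 0) (hvw : inn v w = 0)
    (h : w 0 ≠ 0) : v = (v 0 / w 0) • w := by
  have key : (w 0 * v 1 - v 0 * w 1) ^ 2 + (w 0 * v 2 - v 0 * w 2) ^ 2 = 0 := by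
    simp only [inn] at hv hw hvw
    linear_combination (w 0) ^ 2 * hv + (v 0) ^ 2 * hw - 2 * v 0 * w 0 * hvw
  have h1 : w 0 * v 1 - v 0 * w 1 = 0 := by
    nlinarith [sq_nonneg (w 0 * v 1 - v 0 * w 1), sq_nonneg (w 0 * v 2 - v 0 * w 2)]
  have h2 : w 0 * v 2 - v 0 * w 2 = 0 := by
    nlinarith [sq_nonneg (w 0 * v 1 - v 0 * w 1), sq_nonneg (w 0 * v 2 - v 0 * w 2)]
  ext i
  fin_cases i
  · simp [h]
  · simp; field_simp; linarith
  · simp; field_simp; linarith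

section Calculus

variable {E : Type*} [NormedAddCommGroup E] [NormedSpace ℝ E]

theorem hasFDerivAt_inn {f g : E → Mink} {f' g' : E →L[ℝ] Mink} {x : E} (hf : HasFDerivAt f f' x)
    (hg : HasFDerivAt g g' x) : ∃ L : E →L[ℝ] ℝ, HasFDerivAt (fun y => inn (f y) (g y)) L x ∧
      ∀ w, L w = inn (f' w) (g x) + inn (f x) (g' w) := by
  have hf i := hasFDerivAt_pi'.1 hf i
  have hg i := hasFDerivAt_pi'.1 hg i
  refine ⟨_, ((((hf 0).mul (hg 0)).neg.add ((hf 1).mul (hg 1))).add ((hf 2).mul (hg 2))), ?_⟩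
  intro w
  simp [inn]
  ring

theorem fderiv_inn_apply {f g : E → Mink} {x : E} (hf : DifferentiableAt ℝ f x)
    (hg : DifferentiableAt ℝ g x) (w : E) :
    fderiv ℝ (fun y => inn (f y) (g y)) x w =
      inn (fderiv ℝ f x w) (g x) + inn (f x) (fderiv ℝ g x w) := by
  obtain ⟨L, hL, h⟩ := hasFDerivAt_inn hf.hasFDerivAt hg.hasFDerivAt
  rw [hL.fderiv, h]

theorem hasDerivAt_inn {f g : ℝ → Mink} {f' g' : Mink} {x : ℝ} (hf : HasDerivAt f f' x)
    (hg : HasDerivAt g g' x) :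
    HasDerivAt (fun y => inn (f y) (g y)) (inn f' (g x) + inn (f x) g') x := by
  have hf i := hasDerivAt_pi.1 hf i
  have hg i := hasDerivAt_pi.1 hg i
  refine ((((hf 0).mul (hg 0)).neg.add ((hf 1).mul (hg 1))).add ((hf 2).mul (hg 2))).congr_deriv ?_
  simp [inn]
  ring

theorem contDiffOn_inn {n : WithTop ℕ∞} {f g : E → Mink} {s : Set E} (hf : ContDiffOn ℝ n f s)
    (hg : ContDiffOn ℝ n g s) : ContDiffOn ℝ n (fun y => inn (f y) (g y)) s := by
  have hf i := contDiffOn_pi.1 hf i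
  have hg i := contDiffOn_pi.1 hg i
  exact (((hf 0).mul (hg 0)).neg.add ((hf 1).mul (hg 1))).add ((hf 2).mul (hg 2))

theorem eventually_eq_of_fderiv_eq_zero {F : Type*} [NormedAddCommGroup F] [NormedSpace ℝ F]
    {f : E → F} {U : Set E} (hU : IsOpen U) (hf : DifferentiableOn ℝ f U)
    (h : ∀ x ∈ U, fderiv ℝ f x = 0) {a : E} (ha : a ∈ U) : ∀ᶠ x in nhds a, f x = f a := by
  obtain ⟨ε, hε, hb⟩ := Metric.isOpen_iff.1 hU a ha
  filter_upwards [Metric.ball_mem_nhds a hε] with x hx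
  refine (convex_ball a ε).is_const_of_fderivWithin_eq_zero (𝕜 := ℝ) (hf.mono hb) ?_ hx
    (Metric.mem_ball_self hε)
  intro y hy
  rw [fderivWithin_of_isOpen Metric.isOpen_ball hy, h y (hb hy)]

end Calculus

/-! ### Local parametrizations -/

/-- The projection `(x⁰, x¹, x²) ↦ (x¹, x²)`. -/
def spatial : Mink →L[ℝ] ℝ × ℝ :=
  (ContinuousLinearMap.proj 1).prod (ContinuousLinearMap.proj 2)

theorem spatial_apply (v : Mink) : spatial v = (v 1, v 2) := rfl

/-- A degenerate plane is orthogonal to a null vector with nonzero time component, so it meets the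
time axis only in `0`. Hence lightlike surfaces are local graphs over the `(x¹, x²)`-plane, the
source of all charts below. -/
theorem eq_zero_of_spatial_eq_zero {V : Submodule ℝ Mink} (hV : IsDegenerate V) {x : Mink}
    (hx : x ∈ V) (h : spatial x = 0) : x = 0 := by
  obtain ⟨v, hv, hv0, hvV⟩ := hV
  have h0 := time_ne_zero_of_null (hvV v hv) hv0
  have hvx := hvV x hx
  simp only [spatial_apply, Prod.mk_eq_zero] at h
  simp only [inn, h.1, h.2, mul_zero, add_zero, neg_eq_zero, mul_eq_zero, h0, false_or] at hvx
  ext i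
  fin_cases i
  exacts [hvx, h.1, h.2]

theorem mem_tangentPlane (X : ℝ × ℝ → Mink) (q w : ℝ × ℝ) : fderiv ℝ X q w ∈ tangentPlane X q :=
  ⟨w, rfl⟩

theorem exists_spatial_chart {U : Set (ℝ × ℝ)} (hU : IsOpen U) {X : ℝ × ℝ → Mink}
    (hX : ContDiffOn ℝ ∞ X U) {q : ℝ × ℝ} (hq : q ∈ U) (hinj : Function.Injective (fderiv ℝ X q))
    (hdeg : IsDegenerate (tangentPlane X q)) :
    ∃ e : OpenPartialHomeomorph (ℝ × ℝ) (ℝ × ℝ), q ∈ e.source ∧ e.source ⊆ U ∧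
      (∀ x, e x = spatial (X x)) ∧ ContDiffOn ℝ ∞ e.symm e.target := by
  refine exists_smooth_inverse hU (spatial.contDiff.comp_contDiffOn hX) hq ?_
  have hd : HasFDerivAt (spatial ∘ X) (spatial ∘L fderiv ℝ X q) q :=
    spatial.hasFDerivAt.comp q
      ((hX.contDiffAt (hU.mem_nhds hq)).differentiableAt (by simp)).hasFDerivAt
  rw [hd.fderiv, injective_iff_map_eq_zero]
  intro w hw
  have := eq_zero_of_spatial_eq_zero hdeg (mem_tangentPlane X q w) hw
  exact (injective_iff_map_eq_zero _).1 hinj w this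

namespace IsLocalParam

variable {S : Set Mink} {U V : Set (ℝ × ℝ)} {X Y : ℝ × ℝ → Mink}

theorem contDiffAt (h : IsLocalParam S U X) {q : ℝ × ℝ} (hq : q ∈ U) : ContDiffAt ℝ ∞ X q :=
  h.smooth.contDiffAt (h.isOpen.mem_nhds hq)

theorem differentiableAt (h : IsLocalParam S U X) {q : ℝ × ℝ} (hq : q ∈ U) :
    DifferentiableAt ℝ X q :=
  (h.contDiffAt hq).differentiableAt (by simp)

theorem exists_isOpen_image (h : IsLocalParam S U X) (hV : IsOpen V) (hVU : V ⊆ U) :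
    ∃ O : Set Mink, IsOpen O ∧ X '' V = O ∩ S := by
  have hV' : IsOpen ((↑) ⁻¹' V : Set U) := hV.preimage continuous_subtype_val
  obtain ⟨O, hO, hOV⟩ := isOpen_induced_iff.1 (h.isOpenEmbedding.isOpenMap _ hV')
  refine ⟨O, hO, ?_⟩
  ext x
  constructor
  · rintro ⟨q, hq, rfl⟩
    have hS := h.mapsTo (hVU hq)
    refine ⟨?_, hS⟩
    have : (⟨X q, hS⟩ : S) ∈ (↑) ⁻¹' O := by
      rw [hOV]
      exact ⟨⟨q, hVU hq⟩, hq, rfl⟩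
    exact this
  · rintro ⟨hxO, hxS⟩
    have : (⟨x, hxS⟩ : S) ∈ (↑) ⁻¹' O := hxO
    rw [hOV] at this
    obtain ⟨⟨q, hqU⟩, hq, hqx⟩ := this
    exact ⟨q, hq, congrArg Subtype.val hqx⟩

theorem image_mem_nhdsWithin (h : IsLocalParam S U X) (hV : IsOpen V) (hVU : V ⊆ U) {q : ℝ × ℝ}
    (hq : q ∈ V) : X '' V ∈ nhdsWithin (X q) S := by
  obtain ⟨O, hO, hOV⟩ := h.exists_isOpen_image hV hVU
  have hqO : X q ∈ O ∩ S := hOV ▸ Set.mem_image_of_mem X hq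
  rw [hOV, Set.inter_comm]
  exact inter_mem_nhdsWithin S (hO.mem_nhds hqO.1)

theorem mono (h : IsLocalParam S U X) (hV : IsOpen V) (hVU : V ⊆ U) : IsLocalParam S V X where
  isOpen := hV
  smooth := h.smooth.mono hVU
  immersion q hq := h.immersion q (hVU hq)
  mapsTo := h.mapsTo.mono_left hVU
  isOpenEmbedding :=
    h.isOpenEmbedding.comp (g := h.mapsTo.restrict X U S) (f := Set.inclusion hVU)
      (by
        refine ⟨Topology.IsEmbedding.inclusion hVU, ?_⟩
        rw [Set.range_inclusion]
        exact hV.preimage continuous_subtype_val)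

/-- The change of parameters is the inverse of the spatial chart of `Y` applied to `spatial ∘ X`. It
is valid near `q` because `Y` covers a neighbourhood of `Y r` in `S`. -/
theorem transition (hX : IsLocalParam S U X) (hY : IsLocalParam S V Y) {q r : ℝ × ℝ} (hq : q ∈ U)
    (hr : r ∈ V) (hqr : X q = Y r) (hdeg : IsDegenerate (tangentPlane Y r)) :
    ∃ ψ : ℝ × ℝ → ℝ × ℝ, DifferentiableAt ℝ ψ q ∧ ψ q = r ∧
      ∀ᶠ q' in nhds q, ψ q' ∈ V ∧ X q' = Y (ψ q') := by
  obtain ⟨e, hre, heV, he, hes⟩ := exists_spatial_chart hY.isOpen hY.smooth hr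
    (hY.immersion r hr) hdeg
  have hsym : ∀ r' ∈ e.source, e.symm (spatial (Y r')) = r' := fun r' hr' => by
    rw [← he]; exact e.left_inv hr'
  refine ⟨fun q' => e.symm (spatial (X q')), ?_, ?_, ?_⟩
  · have h1 : DifferentiableAt ℝ e.symm (spatial (X q)) := by
      have ht : spatial (X q) ∈ e.target := by
        rw [hqr, ← he]; exact e.map_source hre
      exact (hes.contDiffAt (e.open_target.mem_nhds ht)).differentiableAt (by simp)
    exact h1.comp q (spatial.differentiableAt.comp q (hX.differentiableAt hq))
  · simp only [hqr]
    exact hsym r hre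
  · have h1 := hY.image_mem_nhdsWithin e.open_source heV hre
    rw [← hqr] at h1
    have h2 : Filter.Tendsto X (nhds q) (nhdsWithin (X q) S) := by
      refine tendsto_nhdsWithin_iff.2 ⟨(hX.differentiableAt hq).continuousAt, ?_⟩
      filter_upwards [hX.isOpen.mem_nhds hq] with q' hq' using hX.mapsTo hq'
    filter_upwards [h2 h1] with q' hq'
    obtain ⟨r', hr', h⟩ := hq'
    rw [← h, hsym r' hr']
    exact ⟨heV hr', rfl⟩

theorem tangentPlane_le (hX : IsLocalParam S U X) (hY : IsLocalParam S V Y) {q r : ℝ × ℝ}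
    (hq : q ∈ U) (hr : r ∈ V) (hqr : X q = Y r) (hdeg : IsDegenerate (tangentPlane Y r)) :
    tangentPlane X q ≤ tangentPlane Y r := by
  obtain ⟨ψ, hψ, rfl, h⟩ := hX.transition hY hq hr hqr hdeg
  have hd : HasFDerivAt X ((fderiv ℝ Y (ψ q)).comp (fderiv ℝ ψ q)) q :=
    ((hY.differentiableAt hr).hasFDerivAt.comp q hψ.hasFDerivAt).congr_of_eventuallyEq
      (h.mono fun _ h => h.2)
  rintro x ⟨w, rfl⟩
  refine ⟨fderiv ℝ ψ q w, ?_⟩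
  rw [hd.fderiv]
  rfl

theorem finrank_tangentPlane (hX : IsLocalParam S U X) {q : ℝ × ℝ} (hq : q ∈ U) :
    Module.finrank ℝ (tangentPlane X q) = 2 := by
  have hf : Module.finrank ℝ (ℝ × ℝ) = 2 := by simp
  rw [tangentPlane, LinearMap.finrank_range_of_inj (hX.immersion q hq), hf]

/-- Composed with `spatial`, the map `Y` becomes the homeomorphism `e`, so `Y` is itself an
embedding; only openness of the image in `S` has to be supplied. -/
theorem of_chart (e : OpenPartialHomeomorph (ℝ × ℝ) (ℝ × ℝ)) (he : ∀ x, e x = spatial (Y x))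
    (hs : ContDiffOn ℝ ∞ Y e.source) (hi : ∀ q ∈ e.source, Function.Injective (fderiv ℝ Y q))
    (hm : Set.MapsTo Y e.source S) (ho : ∃ O, IsOpen O ∧ Y '' e.source = O ∩ S) :
    IsLocalParam S e.source Y where
  isOpen := e.open_source
  smooth := hs
  immersion := hi
  mapsTo := hm
  isOpenEmbedding := by
    refine ⟨Topology.IsEmbedding.of_comp (g := fun x : S => spatial x)
      (hs.continuousOn.mapsToRestrict hm) (by fun_prop) ?_, ?_⟩
    · have := e.isOpenEmbedding_restrict.isEmbedding
      convert! this using 1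
      ext q <;> simp [he]
    · obtain ⟨O, hO, h⟩ := ho
      rw [Set.MapsTo.range_restrict, h]
      convert! hO.preimage (continuous_subtype_val (p := (· ∈ S))) using 1
      ext x; simp

end IsLocalParam

theorem exists_isLocalParam_image {V : Set (ℝ × ℝ)} {Y : ℝ × ℝ → Mink} (hV : IsOpen V)
    (hs : ContDiffOn ℝ ∞ Y V) (hi : ∀ q ∈ V, Function.Injective (fderiv ℝ Y q)) {r : ℝ × ℝ}
    (hr : r ∈ V) (hdeg : IsDegenerate (tangentPlane Y r)) :
    ∃ W ⊆ V, r ∈ W ∧ IsLocalParam (Y '' W) W Y := by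
  obtain ⟨e, hre, heV, he, -⟩ := exists_spatial_chart hV hs hr (hi r hr) hdeg
  exact ⟨e.source, heV, hre, .of_chart e he (hs.mono heV) (fun q hq => hi q (heV hq))
    (Set.mapsTo_image Y _) ⟨Set.univ, isOpen_univ, by simp⟩⟩

/-- Near `r`, an immersed piece of `S` and a parametrized piece of `S` are graphs over the same
plane. Points of the two with equal projection coincide, so the image of `Y` is the `X`-image of an
open set and is open in `S`. -/
theorem IsRegularSurface.exists_isLocalParam {S : Set Mink} (hS : IsRegularSurface S)
    (hSl : IsLightlike S) {V : Set (ℝ × ℝ)} {Y : ℝ × ℝ → Mink} (hV : IsOpen V)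
    (hs : ContDiffOn ℝ ∞ Y V) (hi : ∀ q ∈ V, Function.Injective (fderiv ℝ Y q))
    (hm : Set.MapsTo Y V S) {r : ℝ × ℝ} (hr : r ∈ V) (hdeg : IsDegenerate (tangentPlane Y r)) :
    ∃ W ⊆ V, r ∈ W ∧ IsLocalParam S W Y := by
  obtain ⟨U, X, hX, q, hq, hqr⟩ := hS (Y r) (hm hr)
  obtain ⟨f, hqf, hfU, hf, -⟩ := exists_spatial_chart hX.isOpen hX.smooth hq (hX.immersion q hq)
    (hSl U X hX q hq)
  obtain ⟨e, hre, heV, he, -⟩ := exists_spatial_chart hV hs hr (hi r hr) hdeg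
  obtain ⟨O, hO, hOf⟩ := hX.exists_isOpen_image f.open_source hfU
  -- Cutting down to `Y ⁻¹' O` guarantees that each `Y x` already lies in the graph `X '' f.source`.
  have hopen : IsOpen (V ∩ Y ⁻¹' O) := hs.continuousOn.isOpen_inter_preimage hV hO
  set e' := e.restrOpen _ hopen
  have hsV : e'.source ⊆ V := fun x hx => hx.2.1
  have hrO : Y r ∈ O := by
    have : X q ∈ O ∩ S := hOf ▸ Set.mem_image_of_mem X hqf
    exact hqr ▸ this.1
  have hlift : ∀ x ∈ e'.source, ∃ y ∈ f.source, X y = Y x ∧ f.symm (e' x) = y := by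
    intro x hx
    have : Y x ∈ X '' f.source := hOf ▸ ⟨hx.2.2, hm hx.2.1⟩
    obtain ⟨y, hy, hyx⟩ := this
    refine ⟨y, hy, hyx, ?_⟩
    have : e' x = f y := by rw [hf, hyx]; exact he x
    rw [this, f.left_inv hy]
  refine ⟨e'.source, hsV, ⟨hre, hr, hrO⟩, .of_chart e' he (hs.mono hsV)
    (fun q hq => hi q (hsV hq)) (hm.mono_left hsV) ?_⟩
  have ht : e'.target ⊆ f.target := by
    intro y hy
    obtain ⟨y', hy', h1, h2⟩ := hlift _ (e'.map_target hy)
    have : y = f y' := by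
      rw [hf, h1, ← he]; exact (e'.right_inv hy).symm
    exact this ▸ f.map_source hy'
  have hopen' : IsOpen (f.symm '' e'.target) :=
    f.symm.isOpen_image_of_subset_source e'.open_target ht
  have himg : Y '' e'.source = X '' (f.symm '' e'.target) := by
    ext z
    constructor
    · rintro ⟨x, hx, rfl⟩
      obtain ⟨y, hy, hyx, h⟩ := hlift x hx
      exact ⟨y, ⟨e' x, e'.map_source hx, h⟩, hyx⟩
    · rintro ⟨_, ⟨y, hy, rfl⟩, rfl⟩
      obtain ⟨y', hy', hyx, h⟩ := hlift _ (e'.map_target hy)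
      refine ⟨e'.symm y, e'.map_target hy, ?_⟩
      rw [← hyx, ← h, e'.right_inv hy]
  rw [himg]
  refine hX.exists_isOpen_image hopen' ?_
  rintro _ ⟨y, hy, rfl⟩
  exact hfU (f.map_target (ht hy))

/-! ### Adapted frames -/

/-- The Gram determinant is `-δ²` with `δ = det (a, b, c)`, so the three vectors form a basis;
Cramer's rule then gives `δ x = 0`. -/
theorem eq_zero_of_gram {a b c x : Mink}
    (hG : inn a a * (inn b b * inn c c - inn b c ^ 2) -
      inn a b * (inn a b * inn c c - inn b c * inn a c) +
      inn a c * (inn a b * inn b c - inn b b * inn a c) ≠ 0)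
    (ha : inn x a = 0) (hb : inn x b = 0) (hc : inn x c = 0) : x = 0 := by
  set δ : ℝ := a 0 * (b 1 * c 2 - b 2 * c 1) - a 1 * (b 0 * c 2 - b 2 * c 0) +
    a 2 * (b 0 * c 1 - b 1 * c 0) with hδ
  have hδ0 : δ ≠ 0 := by
    intro h
    apply hG
    have : inn a a * (inn b b * inn c c - inn b c ^ 2) -
      inn a b * (inn a b * inn c c - inn b c * inn a c) +
      inn a c * (inn a b * inn b c - inn b b * inn a c) = -δ ^ 2 := by
      simp only [inn, hδ]; ring
    rw [this, h]; simp
  simp only [inn] at ha hb hc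
  have h0 : δ * x 0 = 0 := by
    linear_combination (-(b 1 * c 2 - b 2 * c 1)) * ha + (a 1 * c 2 - a 2 * c 1) * hb -
      (a 1 * b 2 - a 2 * b 1) * hc
  have h1 : δ * x 1 = 0 := by
    linear_combination (-(b 0 * c 2 - b 2 * c 0)) * ha + (a 0 * c 2 - a 2 * c 0) * hb -
      (a 0 * b 2 - a 2 * b 0) * hc
  have h2 : δ * x 2 = 0 := by
    linear_combination (b 0 * c 1 - b 1 * c 0) * ha - (a 0 * c 1 - a 1 * c 0) * hb +
      (a 0 * b 1 - a 1 * b 0) * hc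
  ext i
  fin_cases i
  · exact (mul_eq_zero.1 h0).resolve_left hδ0
  · exact (mul_eq_zero.1 h1).resolve_left hδ0
  · exact (mul_eq_zero.1 h2).resolve_left hδ0

/-- The basis dual to `(e₀, e₁, e₂)` under the inner product is `(e₂, e₁, e₀)`. -/
theorem expand_of_adapted {e₀ e₁ e₂ : Mink} (h00 : inn e₀ e₀ = 0) (h01 : inn e₀ e₁ = 0)
    (h12 : inn e₁ e₂ = 0) (h22 : inn e₂ e₂ = 0) (h02 : inn e₀ e₂ = 1) (h11 : inn e₁ e₁ = 1)
    (v : Mink) : v = inn e₂ v • e₀ + inn e₁ v • e₁ + inn e₀ v • e₂ := by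
  have h10 : inn e₁ e₀ = 0 := by rw [inn_comm, h01]
  have h21 : inn e₂ e₁ = 0 := by rw [inn_comm, h12]
  have h20 : inn e₂ e₀ = 1 := by rw [inn_comm, h02]
  rw [← sub_eq_zero]
  refine eq_zero_of_gram (a := e₀) (b := e₁) (c := e₂) ?_ ?_ ?_ ?_
  · simp [h00, h01, h02, h11, h12, h22]
  all_goals simp [inn_sub_left, inn_add_left, inn_smul_left, h00, h01, h02, h11, h12, h22, h10,
      h21, h20, inn_comm v]

/-- The linear form `w ↦ ⟨v, w⟩`. -/
noncomputable def innCLM (v : Mink) : Mink →L[ℝ] ℝ :=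
  LinearMap.toContinuousLinearMap
    { toFun := inn v
      map_add' := inn_add_right v
      map_smul' := fun c w => inn_smul_right c v w }

namespace IsZeroAdapted

variable {S : Set Mink} {U V : Set (ℝ × ℝ)} {X Y : ℝ × ℝ → Mink} {E F : Fin 3 → ℝ × ℝ → Mink}
  {q r : ℝ × ℝ} {a b : ℝ}

theorem expand (hE : IsZeroAdapted U X E) (hq : q ∈ U) (v : Mink) :
    v = inn (E 2 q) v • E 0 q + inn (E 1 q) v • E 1 q + inn (E 0 q) v • E 2 q :=
  expand_of_adapted (hE.inn_zero_zero q hq) (hE.inn_zero_one q hq) (hE.inn_one_two q hq)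
    (hE.inn_two_two q hq) (hE.inn_zero_two q hq) (hE.inn_one_one q hq) v

theorem zero_mem (hE : IsZeroAdapted U X E) (hq : q ∈ U) : E 0 q ∈ tangentPlane X q := by
  rw [← hE.span_eq q hq]; exact Submodule.subset_span (by simp)

theorem one_mem (hE : IsZeroAdapted U X E) (hq : q ∈ U) : E 1 q ∈ tangentPlane X q := by
  rw [← hE.span_eq q hq]; exact Submodule.subset_span (by simp)

theorem inn_zero_of_mem (hE : IsZeroAdapted U X E) (hq : q ∈ U) {v : Mink}
    (hv : v ∈ tangentPlane X q) : inn (E 0 q) v = 0 := by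
  rw [← hE.span_eq q hq, Submodule.mem_span_pair] at hv
  obtain ⟨c, d, rfl⟩ := hv
  rw [inn_add_right, inn_smul_right, inn_smul_right, hE.inn_zero_zero q hq, hE.inn_zero_one q hq]
  ring

theorem inn_zero_fderiv (hE : IsZeroAdapted U X E) (hq : q ∈ U) (w : ℝ × ℝ) :
    inn (E 0 q) (fderiv ℝ X q w) = 0 :=
  hE.inn_zero_of_mem hq (mem_tangentPlane X q w)

theorem zero_ne_zero (hE : IsZeroAdapted U X E) (hq : q ∈ U) : E 0 q ≠ 0 := by
  intro h
  have := hE.inn_zero_two q hq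
  rw [h, inn_zero_left] at this
  exact zero_ne_one this

theorem time_ne_zero (hE : IsZeroAdapted U X E) (hq : q ∈ U) : E 0 q 0 ≠ 0 :=
  time_ne_zero_of_null (hE.inn_zero_zero q hq) (hE.zero_ne_zero hq)

theorem isDegenerate (hE : IsZeroAdapted U X E) (hq : q ∈ U) : IsDegenerate (tangentPlane X q) :=
  ⟨_, hE.zero_mem hq, hE.zero_ne_zero hq, fun _ hw => hE.inn_zero_of_mem hq hw⟩

theorem differentiableAt (hE : IsZeroAdapted U X E) (hU : IsOpen U) (hq : q ∈ U) (α : Fin 3) :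
    DifferentiableAt ℝ (E α) q :=
  ((hE.smooth α).contDiffAt (hU.mem_nhds hq)).differentiableAt (by simp)

theorem inn_zero_fderiv_zero (hE : IsZeroAdapted U X E) (hU : IsOpen U) (hq : q ∈ U) (w : ℝ × ℝ) :
    inn (E 0 q) (fderiv ℝ (E 0) q w) = 0 := by
  have hd := hE.differentiableAt hU hq 0
  have h1 := fderiv_inn_apply hd hd w
  have h2 : (fun y => inn (E 0 y) (E 0 y)) =ᶠ[nhds q] fun _ => (0 : ℝ) := by
    filter_upwards [hU.mem_nhds hq] with y hy using hE.inn_zero_zero y hy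
  rw [h2.fderiv_eq] at h1
  simp only [fderiv_fun_const, Pi.zero_apply, zero_apply,
    inn_comm (fderiv ℝ (E 0) q w)] at h1
  linarith

theorem exists_isMaurerCartanAt (hE : IsZeroAdapted U X E) (hq : q ∈ U) :
    ∃ η Θ, IsMaurerCartanAt X E q η Θ := by
  let D : Fin 3 → Mink →L[ℝ] ℝ := ![innCLM (E 2 q), innCLM (E 1 q), innCLM (E 0 q)]
  have hD : ∀ v, v = ∑ α, D α v • E α q := by
    intro v
    rw [Fin.sum_univ_three]
    exact hE.expand hq v
  exact ⟨fun α => (D α).comp (fderiv ℝ X q), fun α β => (D α).comp (fderiv ℝ (E β) q),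
    fun w => hD _, fun β w => hD _⟩

theorem inn_one_sum (hE : IsZeroAdapted U X E) (hq : q ∈ U) (c : Fin 3 → ℝ) :
    inn (E 1 q) (∑ α, c α • E α q) = c 1 := by
  simp [Fin.sum_univ_three, inn_add_right, inn_smul_right, hE.inn_one_one q hq,
    hE.inn_one_two q hq, inn_comm (E 1 q) (E 0 q), hE.inn_zero_one q hq]

theorem inn_two_sum (hE : IsZeroAdapted U X E) (hq : q ∈ U) (c : Fin 3 → ℝ) :
    inn (E 2 q) (∑ α, c α • E α q) = c 0 := by
  simp [Fin.sum_univ_three, inn_add_right, inn_smul_right, hE.inn_two_two q hq,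
    inn_comm (E 2 q) (E 1 q), hE.inn_one_two q hq, inn_comm (E 2 q) (E 0 q), hE.inn_zero_two q hq]

theorem hasA1_iff_inn (hE : IsZeroAdapted U X E) (hq : q ∈ U) : HasA1 X E q a ↔
    ∀ w, inn (E 1 q) (fderiv ℝ (E 0) q w) = a * inn (E 1 q) (fderiv ℝ X q w) := by
  constructor
  · rintro ⟨η, Θ, h, ha⟩ w
    rw [h.de, h.dx, hE.inn_one_sum hq, hE.inn_one_sum hq, ha]
    rfl
  · intro h
    obtain ⟨η, Θ, hM⟩ := hE.exists_isMaurerCartanAt hq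
    refine ⟨η, Θ, hM, ContinuousLinearMap.ext fun w => ?_⟩
    have := h w
    rwa [hM.de, hM.dx, hE.inn_one_sum hq, hE.inn_one_sum hq] at this

/-- Neither `dx` nor `de₀` has an `e₂`-component, since `e₀` is normal to the surface and null.
Matching the `e₁`-components therefore leaves only a multiple of `e₀`. This form of the condition no
longer involves `e₁` and `e₂`. -/
theorem hasA1_iff (hE : IsZeroAdapted U X E) (hU : IsOpen U) (hq : q ∈ U) : HasA1 X E q a ↔
    ∀ w, ∃ c : ℝ, fderiv ℝ (E 0) q w = a • fderiv ℝ X q w + c • E 0 q := by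
  rw [hE.hasA1_iff_inn hq]
  refine forall_congr' fun w => ⟨fun h => ?_, ?_⟩
  · refine ⟨inn (E 2 q) (fderiv ℝ (E 0) q w - a • fderiv ℝ X q w), ?_⟩
    have := hE.expand hq (fderiv ℝ (E 0) q w - a • fderiv ℝ X q w)
    rw [inn_sub_right (E 1 q), inn_sub_right (E 0 q), inn_smul_right, inn_smul_right,
      hE.inn_zero_fderiv hq, hE.inn_zero_fderiv_zero hU hq, h] at this
    rw [← sub_eq_iff_eq_add']
    simpa using this
  · rintro ⟨c, h⟩
    rw [h, inn_add_right, inn_smul_right, inn_smul_right, inn_comm (E 1 q) (E 0 q),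
      hE.inn_zero_one q hq]
    ring

theorem exists_inn_one_fderiv (hE : IsZeroAdapted U X E) (hq : q ∈ U) :
    ∃ w, inn (E 1 q) (fderiv ℝ X q w) = 1 := by
  obtain ⟨w, hw⟩ := hE.one_mem hq
  refine ⟨w, ?_⟩
  have : fderiv ℝ X q w = E 1 q := hw
  rw [this, hE.inn_one_one q hq]

theorem hasA1_unique (hE : IsZeroAdapted U X E) (hq : q ∈ U) (ha : HasA1 X E q a)
    (hb : HasA1 X E q b) : a = b := by
  obtain ⟨w, hw⟩ := hE.exists_inn_one_fderiv hq
  have h1 := (hE.hasA1_iff_inn hq).1 ha w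
  have h2 := (hE.hasA1_iff_inn hq).1 hb w
  rw [hw] at h1 h2
  linarith

/-- The null line of a lightlike plane is intrinsic; comparing time components gives the factor. -/
theorem eq_smul_of_eq (hX : IsLocalParam S U X) (hY : IsLocalParam S V Y)
    (hE : IsZeroAdapted U X E) (hF : IsZeroAdapted V Y F) (hq : q ∈ U) (hr : r ∈ V)
    (hqr : X q = Y r) : E 0 q = (E 0 q 0 / F 0 r 0) • F 0 r := by
  have hmem := hX.tangentPlane_le hY hq hr hqr (hF.isDegenerate hr) (hE.zero_mem hq)
  refine eq_smul_of_null (hE.inn_zero_zero q hq) (hF.inn_zero_zero r hr) ?_ (hF.time_ne_zero hr)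
  rw [inn_comm]
  exact hF.inn_zero_of_mem hr hmem

theorem transition (hX : IsLocalParam S U X) (hY : IsLocalParam S V Y)
    (hE : IsZeroAdapted U X E) (hF : IsZeroAdapted V Y F) (hq : q ∈ U) (hr : r ∈ V)
    (hqr : X q = Y r) : ∃ ψ : ℝ × ℝ → ℝ × ℝ, DifferentiableAt ℝ ψ q ∧ ψ q = r ∧
      (∀ᶠ q' in nhds q, q' ∈ U ∧ ψ q' ∈ V ∧ X q' = Y (ψ q') ∧
        E 0 q' = (E 0 q' 0 / F 0 (ψ q') 0) • F 0 (ψ q')) ∧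
      fderiv ℝ X q = (fderiv ℝ Y r).comp (fderiv ℝ ψ q) := by
  obtain ⟨ψ, hψ, hψr, h⟩ := hX.transition hY hq hr hqr (hF.isDegenerate hr)
  refine ⟨ψ, hψ, hψr, ?_, ?_⟩
  · filter_upwards [h, hX.isOpen.mem_nhds hq] with q' h' hq'
    exact ⟨hq', h'.1, h'.2, hE.eq_smul_of_eq hX hY hF hq' h'.1 h'.2⟩
  · subst hψr
    exact (((hY.differentiableAt hr).hasFDerivAt.comp q hψ.hasFDerivAt).congr_of_eventuallyEq
      (h.mono fun _ h => h.2)).fderiv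

/-- If `e₀ = l f₀`, then `de₀ = l df₀ + dl f₀ ≡ l b dx` modulo the null direction, so `a₁` scales
with `e₀`. -/
theorem hasA1_of_eq (hX : IsLocalParam S U X) (hY : IsLocalParam S V Y)
    (hE : IsZeroAdapted U X E) (hF : IsZeroAdapted V Y F) (hq : q ∈ U) (hr : r ∈ V)
    (hqr : X q = Y r) (h : HasA1 Y F r b) : HasA1 X E q (E 0 q 0 / F 0 r 0 * b) := by
  obtain ⟨ψ, hψ, rfl, hev, hd⟩ := hE.transition hX hY hF hq hr hqr
  have hE0 := hev.self_of_nhds.2.2.2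
  have hFψ : HasFDerivAt (fun q' => F 0 (ψ q')) ((fderiv ℝ (F 0) (ψ q)).comp (fderiv ℝ ψ q)) q :=
    (hF.differentiableAt hY.isOpen hr 0).hasFDerivAt.comp q hψ.hasFDerivAt
  have hl : DifferentiableAt ℝ (fun q' => E 0 q' 0 / F 0 (ψ q') 0) q := by
    have h1 := differentiableAt_pi.1 (hE.differentiableAt hX.isOpen hq 0) 0
    have h2 := differentiableAt_pi.1 hFψ.differentiableAt 0
    simp only [div_eq_mul_inv]
    exact h1.mul (h2.inv (hF.time_ne_zero hr))
  have hdE := (hl.hasFDerivAt.smul hFψ).congr_of_eventuallyEq (hev.mono fun _ h => h.2.2.2)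
  rw [hE.hasA1_iff hX.isOpen hq]
  intro w
  obtain ⟨c, hc⟩ := (hF.hasA1_iff hY.isOpen hr).1 h (fderiv ℝ ψ q w)
  rw [hdE.fderiv, hd]
  set l := E 0 q 0 / F 0 (ψ q) 0 with hldef
  have hl0 : l ≠ 0 := div_ne_zero (hE.time_ne_zero hq) (hF.time_ne_zero hr)
  -- The bracket is the coefficient of `F 0`; the factor `l⁻¹` expresses it through `E 0`.
  refine ⟨l⁻¹ * (l * c + fderiv ℝ (fun q' => E 0 q' 0 / F 0 (ψ q') 0) q w), ?_⟩
  rw [hE0]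
  simp only [add_apply, smul_apply,
    ContinuousLinearMap.comp_apply, ContinuousLinearMap.smulRight_apply, hc]
  rw [smul_smul (l⁻¹ * _), mul_assoc, mul_comm _ l, inv_mul_cancel_left₀ hl0]
  module

end IsZeroAdapted

/-! ### Frames normalized by `a₁ = 1`. -/

namespace IsOneAdapted

variable {S : Set Mink} {U V : Set (ℝ × ℝ)} {X Y : ℝ × ℝ → Mink} {E F : Fin 3 → ℝ × ℝ → Mink}
  {q r : ℝ × ℝ} {a : ℝ}

/-- Both frames have `a₁ = 1`, so the scaling factor between their null vectors is `1`: the vector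
field `e₀` is now intrinsic. -/
theorem eq_of_eq (hX : IsLocalParam S U X) (hY : IsLocalParam S V Y)
    (hE : IsOneAdapted U X E) (hF : IsOneAdapted V Y F) (hq : q ∈ U) (hr : r ∈ V)
    (hqr : X q = Y r) : E 0 q = F 0 r := by
  have h1 := hE.1.hasA1_of_eq hX hY hF.1 hq hr hqr (hF.2 r hr)
  have h2 := hE.1.hasA1_unique hq h1 (hE.2 q hq)
  rw [mul_one] at h2
  have := hE.1.eq_smul_of_eq hX hY hF.1 hq hr hqr
  rwa [h2, one_smul] at this

theorem transition (hX : IsLocalParam S U X) (hY : IsLocalParam S V Y)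
    (hE : IsOneAdapted U X E) (hF : IsOneAdapted V Y F) (hq : q ∈ U) (hr : r ∈ V)
    (hqr : X q = Y r) : ∃ L : ℝ × ℝ →L[ℝ] ℝ × ℝ,
      fderiv ℝ X q = (fderiv ℝ Y r).comp L ∧ fderiv ℝ (E 0) q = (fderiv ℝ (F 0) r).comp L := by
  obtain ⟨ψ, hψ, rfl, hev, hd⟩ := hE.1.transition hX hY hF.1 hq hr hqr
  refine ⟨fderiv ℝ ψ q, hd, ?_⟩
  refine (((hF.1.differentiableAt hY.isOpen hr 0).hasFDerivAt.comp q
    hψ.hasFDerivAt).congr_of_eventuallyEq ?_).fderiv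
  filter_upwards [hev] with q' h using hE.eq_of_eq hX hY hF h.1 h.2.1 h.2.2.1

/-- With `a₁ = 1`, the differential of `e₀ - x` is a multiple of `e₀`, and pairing with `e₂` shows
that its coefficient is `ω⁰₀ - ω⁰`. -/
theorem hasA2_iff (hE : IsOneAdapted U X E) (hU : IsOpen U) (hq : q ∈ U) : HasA2 X E q a ↔
    ∀ w, fderiv ℝ (E 0) q w - fderiv ℝ X q w = (a * inn (E 1 q) (fderiv ℝ X q w)) • E 0 q := by
  have hEz := hE.1
  have key : ∀ w, fderiv ℝ (E 0) q w - fderiv ℝ X q w =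
      (inn (E 2 q) (fderiv ℝ (E 0) q w - fderiv ℝ X q w)) • E 0 q := by
    intro w
    obtain ⟨c, hc⟩ := (hEz.hasA1_iff hU hq).1 (hE.2 q hq) w
    rw [hc, one_smul, add_sub_cancel_left, inn_smul_right, inn_comm, hEz.inn_zero_two q hq,
      mul_one]
  constructor
  · rintro ⟨η, Θ, h, ha⟩ w
    rw [key w, inn_sub_right]
    congr 1
    rw [h.de, h.dx, hEz.inn_two_sum hq, hEz.inn_two_sum hq, hEz.inn_one_sum hq]
    exact congrArg (fun L : ℝ × ℝ →L[ℝ] ℝ => L w) ha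
  · intro h
    obtain ⟨η, Θ, hM⟩ := hEz.exists_isMaurerCartanAt hq
    refine ⟨η, Θ, hM, ContinuousLinearMap.ext fun w => ?_⟩
    have := congrArg (inn (E 2 q)) (h w)
    rw [inn_sub_right, inn_smul_right, inn_comm (E 2 q) (E 0 q), hEz.inn_zero_two q hq, mul_one,
      hM.de, hM.dx, hEz.inn_two_sum hq, hEz.inn_two_sum hq, hEz.inn_one_sum hq] at this
    exact this

end IsOneAdapted

/-! ### Existence of adapted frames -/

/-- The vector `N` with `⟨N, v⟩ = det (a, b, v)`. -/
def lorentzCross (a b : Mink) : Mink :=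
  ![-(a 1 * b 2 - a 2 * b 1), a 2 * b 0 - a 0 * b 2, a 0 * b 1 - a 1 * b 0]

theorem inn_lorentzCross_left (a b : Mink) : inn (lorentzCross a b) a = 0 := by
  simp [inn, lorentzCross]; ring

theorem inn_lorentzCross_right (a b : Mink) : inn (lorentzCross a b) b = 0 := by
  simp [inn, lorentzCross]; ring

theorem inn_lorentzCross_self (a b : Mink) :
    inn (lorentzCross a b) (lorentzCross a b) = inn a b ^ 2 - inn a a * inn b b := by
  simp [inn, lorentzCross]; ring

/-- The cross product `N` of the coordinate vectors is normal to the tangent plane, and `⟨N, N⟩` is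
minus the Gram determinant of the plane, hence zero. So `N` serves as `e₀`, and the rest of the
frame is rational in its components. -/
theorem IsLocalParam.exists_isZeroAdapted {S : Set Mink} {U : Set (ℝ × ℝ)} {X : ℝ × ℝ → Mink}
    (hX : IsLocalParam S U X) (hdeg : ∀ q ∈ U, IsDegenerate (tangentPlane X q)) :
    ∃ E, IsZeroAdapted U X E := by
  set a : ℝ × ℝ → Mink := fun q => fderiv ℝ X q (1, 0) with ha
  set b : ℝ × ℝ → Mink := fun q => fderiv ℝ X q (0, 1) with hb
  set N : ℝ × ℝ → Mink := fun q => lorentzCross (a q) (b q) with hN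
  have hX' : ContDiffOn ℝ ∞ (fderiv ℝ X) U := hX.smooth.fderiv_of_isOpen hX.isOpen (by simp)
  have has : ContDiffOn ℝ ∞ a U := hX'.clm_apply contDiffOn_const
  have hbs : ContDiffOn ℝ ∞ b U := hX'.clm_apply contDiffOn_const
  have hlin : ∀ q w, fderiv ℝ X q w = w.1 • a q + w.2 • b q := by
    intro q w
    rw [ha, hb]
    simp only [← map_smul, ← map_add]
    congr 1
    ext <;> simp
  have hNs : ∀ i, ContDiffOn ℝ ∞ (fun q => N q i) U := by
    have h1 := contDiffOn_pi.1 has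
    have h2 := contDiffOn_pi.1 hbs
    intro i
    fin_cases i
    · exact (((h1 1).mul (h2 2)).sub ((h1 2).mul (h2 1))).neg
    · exact ((h1 2).mul (h2 0)).sub ((h1 0).mul (h2 2))
    · exact ((h1 0).mul (h2 1)).sub ((h1 1).mul (h2 0))
  -- Up to sign, `N q 0` is the Jacobian determinant of `spatial ∘ X`.
  have hN0 : ∀ q ∈ U, N q 0 ≠ 0 := by
    intro q hq h
    have hinj : ∀ w, spatial (fderiv ℝ X q w) = 0 → w = 0 := fun w hw =>
      (injective_iff_map_eq_zero _).1 (hX.immersion q hq) w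
        (eq_zero_of_spatial_eq_zero (hdeg q hq) (mem_tangentPlane X q w) hw)
    have h : a q 1 * b q 2 - a q 2 * b q 1 = 0 := by
      have : -(a q 1 * b q 2 - a q 2 * b q 1) = 0 := h
      linarith
    have h1 := hinj (b q 2, -a q 2) (by
      rw [hlin]; simp [spatial_apply]; constructor <;> linarith)
    have h2 := hinj (b q 1, -a q 1) (by
      rw [hlin]; simp [spatial_apply]; constructor <;> linarith)
    have h3 := hinj (1, 0) (by
      rw [hlin]; simp only [Prod.mk_eq_zero] at h1 h2; simp [spatial_apply]
      constructor <;> linarith)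
    simp at h3
  have hNn : ∀ q ∈ U, inn (N q) (N q) = 0 := by
    intro q hq
    obtain ⟨_, ⟨w, rfl⟩, hv0, hv⟩ := hdeg q hq
    have hw : (fderiv ℝ X q : ℝ × ℝ →ₗ[ℝ] Mink) w = w.1 • a q + w.2 • b q := hlin q w
    have h1 := hv (a q) (mem_tangentPlane X q _)
    have h2 := hv (b q) (mem_tangentPlane X q _)
    rw [hw] at h1 h2 hv0
    simp only [inn_add_left, inn_smul_left, inn_comm (b q) (a q)] at h1 h2
    rw [hN, inn_lorentzCross_self]
    -- The components of the degenerate vector are a nonzero kernel vector of the Gram matrix of `(a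
    -- q, b q)`, so its determinant vanishes.
    have e1 : w.1 * (inn (a q) (b q) ^ 2 - inn (a q) (a q) * inn (b q) (b q)) = 0 := by
      linear_combination inn (a q) (b q) * h2 - inn (b q) (b q) * h1
    have e2 : w.2 * (inn (a q) (b q) ^ 2 - inn (a q) (a q) * inn (b q) (b q)) = 0 := by
      linear_combination inn (a q) (b q) * h1 - inn (a q) (a q) * h2
    rcases mul_eq_zero.1 e1 with e1 | e1
    · rcases mul_eq_zero.1 e2 with e2 | e2
      · simp [e1, e2] at hv0
      · exact e2
    · exact e1
  -- Nullity means `N₁² + N₂² = N₀²`. Thus the spatial part of `N`, rotated by a right angle and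
  -- divided by `N₀`, is a unit vector orthogonal to `N`. Reversing the time component of `N` gives
  -- a second null vector, whose product with `N` is `2 N₀²`.
  let E : Fin 3 → ℝ × ℝ → Mink := ![N, fun q => ![0, -(N q 2 / N q 0), N q 1 / N q 0],
    fun q => ![-(N q 0 / (2 * N q 0 ^ 2)), N q 1 / (2 * N q 0 ^ 2), N q 2 / (2 * N q 0 ^ 2)]]
  have e0 : ∀ q, E 0 q = N q := fun _ => rfl
  have e1 : ∀ q, E 1 q = ![0, -(N q 2 / N q 0), N q 1 / N q 0] := fun _ => rfl
  have e2 : ∀ q, E 2 q = ![-(N q 0 / (2 * N q 0 ^ 2)), N q 1 / (2 * N q 0 ^ 2),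
    N q 2 / (2 * N q 0 ^ 2)] := fun _ => rfl
  have g : ∀ q ∈ U, inn (E 0 q) (E 1 q) = 0 ∧ inn (E 1 q) (E 2 q) = 0 ∧
      inn (E 2 q) (E 2 q) = 0 ∧ inn (E 0 q) (E 2 q) = 1 ∧ inn (E 1 q) (E 1 q) = 1 := by
    intro q hq
    have hn := hNn q hq
    have h0 := hN0 q hq
    rw [e0, e1, e2]
    simp only [inn] at hn ⊢
    simp only [Matrix.cons_val_zero, Matrix.cons_val_one, Matrix.cons_val]
    refine ⟨?_, ?_, ?_, ?_, ?_⟩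
    · ring
    · ring
    · field_simp; linarith
    · field_simp; linarith
    · field_simp; linarith
  refine ⟨E, ?_, ?_, hNn, fun q hq => (g q hq).1, fun q hq => (g q hq).2.1,
    fun q hq => (g q hq).2.2.1, fun q hq => (g q hq).2.2.2.1, fun q hq => (g q hq).2.2.2.2⟩
  · have hN2 : ∀ q ∈ U, 2 * N q 0 ^ 2 ≠ 0 := fun q hq => by have := hN0 q hq; positivity
    have hNs2 : ContDiffOn ℝ ∞ (fun q => 2 * N q 0 ^ 2) U := contDiffOn_const.mul ((hNs 0).pow 2)
    intro α
    rw [contDiffOn_pi]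
    intro i
    fin_cases α <;> fin_cases i
    · exact hNs 0
    · exact hNs 1
    · exact hNs 2
    · exact contDiffOn_const
    · exact ((hNs 2).div (hNs 0) hN0).neg
    · exact (hNs 1).div (hNs 0) hN0
    · exact ((hNs 0).div hNs2 hN2).neg
    · exact (hNs 1).div hNs2 hN2
    · exact (hNs 2).div hNs2 hN2
  · intro q hq
    symm
    obtain ⟨g1, g2, g3, g4, g5⟩ := g q hq
    refine Submodule.eq_of_le_of_finrank_le ?_ ?_
    · rintro _ ⟨w, rfl⟩
      have h := expand_of_adapted (hNn q hq) g1 g2 g3 g4 g5 (fderiv ℝ X q w)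
      have h0 : inn (N q) (fderiv ℝ X q w) = 0 := by
        rw [hlin, inn_add_right, inn_smul_right, inn_smul_right, hN]
        simp only [inn_lorentzCross_left, inn_lorentzCross_right]
        ring
      rw [h0, zero_smul, add_zero] at h
      exact Submodule.mem_span_pair.2 ⟨_, _, h.symm⟩
    · rw [hX.finrank_tangentPlane hq]
      refine (finrank_span_le_card _).trans ?_
      rw [Set.toFinset_card, Fintype.card_ofFinset]
      exact Finset.card_le_two

/-- Rescaling `e₀` by `1 / a₁` and `e₂` by `a₁` normalizes the frame. Smoothness of `1 / a₁` comes
from writing it as `ω¹(w₀) / ω¹₀(w₀)` for a fixed `w₀` with `ω¹(w₀) ≠ 0` near `q₀`. -/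
theorem exists_isOneAdapted {S : Set Mink} {U : Set (ℝ × ℝ)} {X : ℝ × ℝ → Mink}
    (hX : IsLocalParam S U X) (hdeg : ∀ q ∈ U, IsDegenerate (tangentPlane X q))
    (ha : A1NeZero S) {q₀ : ℝ × ℝ} (hq₀ : q₀ ∈ U) :
    ∃ (U' : Set (ℝ × ℝ)) (E : Fin 3 → ℝ × ℝ → Mink), q₀ ∈ U' ∧ IsLocalParam S U' X ∧
      IsOneAdapted U' X E := by
  obtain ⟨E, hE⟩ := hX.exists_isZeroAdapted hdeg
  obtain ⟨w₀, hw₀⟩ := hE.exists_inn_one_fderiv hq₀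
  have hX' : ContDiffOn ℝ ∞ (fun q => fderiv ℝ X q w₀) U :=
    (hX.smooth.fderiv_of_isOpen hX.isOpen (by simp)).clm_apply contDiffOn_const
  have hE' : ContDiffOn ℝ ∞ (fun q => fderiv ℝ (E 0) q w₀) U :=
    ((hE.smooth 0).fderiv_of_isOpen hX.isOpen (by simp)).clm_apply contDiffOn_const
  set num : ℝ × ℝ → ℝ := fun q => inn (E 1 q) (fderiv ℝ X q w₀) with hnum
  set den : ℝ × ℝ → ℝ := fun q => inn (E 1 q) (fderiv ℝ (E 0) q w₀) with hden
  have hnums : ContDiffOn ℝ ∞ num U := contDiffOn_inn (hE.smooth 1) hX'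
  have hdens : ContDiffOn ℝ ∞ den U := contDiffOn_inn (hE.smooth 1) hE'
  set U' : Set (ℝ × ℝ) := U ∩ num ⁻¹' {0}ᶜ with hU'
  have hU'o : IsOpen U' := hnums.continuousOn.isOpen_inter_preimage hX.isOpen isOpen_compl_singleton
  have hsub : U' ⊆ U := fun q hq => hq.1
  have hXU' := hX.mono hU'o hsub
  have hval : ∀ q ∈ U', ∃ a, a ≠ 0 ∧ HasA1 X E q a ∧ den q = a * num q := by
    intro q hq
    obtain ⟨a, ha0, h⟩ := ha U X E hX hE q hq.1
    exact ⟨a, ha0, h, (hE.hasA1_iff_inn hq.1).1 h w₀⟩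
  have hden0 : ∀ q ∈ U', den q ≠ 0 := by
    intro q hq
    obtain ⟨a, ha0, -, h⟩ := hval q hq
    rw [h]
    exact mul_ne_zero ha0 hq.2
  set k : ℝ × ℝ → ℝ := fun q => num q / den q with hk
  have hks : ContDiffOn ℝ ∞ k U' := (hnums.mono hsub).div (hdens.mono hsub) hden0
  have hk0 : ∀ q ∈ U', k q ≠ 0 := fun q hq => div_ne_zero hq.2 (hden0 q hq)
  let E' : Fin 3 → ℝ × ℝ → Mink := ![fun q => k q • E 0 q, E 1, fun q => (k q)⁻¹ • E 2 q]
  have e0 : ∀ q, E' 0 q = k q • E 0 q := fun _ => rfl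
  have e1 : ∀ q, E' 1 q = E 1 q := fun _ => rfl
  have e2 : ∀ q, E' 2 q = (k q)⁻¹ • E 2 q := fun _ => rfl
  have hE'z : IsZeroAdapted U' X E' := by
    refine ⟨?_, ?_, ?_, ?_, ?_, ?_, ?_, ?_⟩
    · intro α
      fin_cases α
      · exact hks.smul ((hE.smooth 0).mono hsub)
      · exact (hE.smooth 1).mono hsub
      · exact (hks.inv hk0).smul ((hE.smooth 2).mono hsub)
    · intro q hq
      rw [← hE.span_eq q hq.1, e0, e1, Submodule.span_insert, Submodule.span_insert (E 0 q),
        Submodule.span_singleton_smul_eq (IsUnit.mk0 _ (hk0 q hq))]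
    · intro q hq
      rw [e0, inn_smul_left, inn_smul_right, hE.inn_zero_zero q hq.1]; simp
    · intro q hq
      rw [e0, e1, inn_smul_left, hE.inn_zero_one q hq.1]; simp
    · intro q hq
      rw [e1, e2, inn_smul_right, hE.inn_one_two q hq.1]; simp
    · intro q hq
      rw [e2, inn_smul_left, inn_smul_right, hE.inn_two_two q hq.1]; simp
    · intro q hq
      rw [e0, e2, inn_smul_left, inn_smul_right, hE.inn_zero_two q hq.1, mul_one,
        mul_inv_cancel₀ (hk0 q hq)]
    · exact fun q hq => hE.inn_one_one q hq.1
  refine ⟨U', E', ⟨hq₀, by simp [hnum, hw₀]⟩, hXU', hE'z, fun q hq => ?_⟩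
  obtain ⟨a, ha0, h, hden_eq⟩ := hval q hq
  rw [hE'z.hasA1_iff_inn hq]
  intro w
  have hkd : DifferentiableAt ℝ k q := (hks.contDiffAt (hU'o.mem_nhds hq)).differentiableAt (by simp)
  have hd : HasFDerivAt (E' 0) _ q :=
    hkd.hasFDerivAt.smul (hE.differentiableAt hX.isOpen hq.1 0).hasFDerivAt
  have hka : k q * a = 1 := by
    rw [hk]
    simp only [hden_eq]
    have : num q ≠ 0 := hq.2
    field_simp
  rw [hd.fderiv, e1]
  simp only [add_apply, smul_apply,
    ContinuousLinearMap.smulRight_apply, inn_add_right, inn_smul_right,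
    (hE.hasA1_iff_inn hq.1).1 h w, inn_comm (E 1 q) (E 0 q), hE.inn_zero_one q hq.1]
  linear_combination inn (E 1 q) (fderiv ℝ X q w) * hka

/-! ### Lightlike planes and light cones -/

/-- With `T` made discrete, the locally constant and uniquely determined datum is a continuous
function on a preconnected set, hence constant. -/
theorem exists_forall_of_locally {T : Type*} {S : Set Mink} (hS : IsPreconnected S)
    (hne : S.Nonempty) {P : Mink → T → Prop}
    (huniq : ∀ x ∈ S, ∀ s t, P x s → P x t → s = t)
    (hloc : ∀ x ∈ S, ∃ t, ∀ᶠ y in nhdsWithin x S, P y t) : ∃ t, ∀ x ∈ S, P x t := by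
  let _ : TopologicalSpace T := ⊥
  have : DiscreteTopology T := ⟨rfl⟩
  obtain ⟨x₀, hx₀⟩ := hne
  have : Nonempty T := ⟨(hloc x₀ hx₀).choose⟩
  choose! f hf using hloc
  have hself : ∀ x ∈ S, P x (f x) := fun x hx => (hf x hx).self_of_nhdsWithin hx
  have hcont : ContinuousOn f S := by
    intro x hx
    refine ContinuousWithinAt.congr_of_eventuallyEq (f := fun _ => f x)
      continuousWithinAt_const ?_ rfl
    filter_upwards [hf x hx, self_mem_nhdsWithin] with y hy hyS
    exact huniq y hyS _ _ (hself y hyS) hy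
  refine ⟨f x₀, fun x hx => ?_⟩
  rw [hS.constant hcont hx₀ hx]
  exact hself x hx

theorem IsLocalParam.eventually_nhdsWithin {S : Set Mink} {U : Set (ℝ × ℝ)} {X : ℝ × ℝ → Mink}
    (hX : IsLocalParam S U X) {q : ℝ × ℝ} (hq : q ∈ U) {R : ℝ × ℝ → Prop}
    (hR : ∀ᶠ q' in nhds q, R q') :
    ∀ᶠ y in nhdsWithin (X q) S, ∃ q' ∈ U, X q' = y ∧ R q' := by
  obtain ⟨V, hV, hVo, hqV⟩ := mem_nhds_iff.1 hR
  filter_upwards [hX.image_mem_nhdsWithin (hVo.inter hX.isOpen) Set.inter_subset_right ⟨hqV, hq⟩]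
  rintro _ ⟨q', hq', rfl⟩
  exact ⟨q', hq'.2, rfl, hV hq'.1⟩

/-- The null direction of the frame, normalized to have time component `1`. -/
noncomputable def nullDir (E : Fin 3 → ℝ × ℝ → Mink) (q : ℝ × ℝ) : Mink := (E 0 q 0)⁻¹ • E 0 q

namespace IsZeroAdapted

variable {S : Set Mink} {U : Set (ℝ × ℝ)} {X : ℝ × ℝ → Mink} {E : Fin 3 → ℝ × ℝ → Mink}
  {q : ℝ × ℝ}

theorem nullDir_time (hE : IsZeroAdapted U X E) (hq : q ∈ U) : nullDir E q 0 = 1 := by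
  simp [nullDir, hE.time_ne_zero hq]

theorem inn_nullDir (hE : IsZeroAdapted U X E) (hq : q ∈ U) :
    inn (nullDir E q) (nullDir E q) = 0 := by
  simp [nullDir, inn_smul_left, inn_smul_right, hE.inn_zero_zero q hq]

theorem smul_nullDir (hE : IsZeroAdapted U X E) (hq : q ∈ U) :
    E 0 q 0 • nullDir E q = E 0 q :=
  smul_inv_smul₀ (hE.time_ne_zero hq) _

theorem contDiffOn_nullDir (hE : IsZeroAdapted U X E) : ContDiffOn ℝ ∞ (nullDir E) U :=
  ((contDiffOn_pi.1 (hE.smooth 0) 0).inv fun _ hq => hE.time_ne_zero hq).smul (hE.smooth 0)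

theorem exists_fderiv_nullDir (hE : IsZeroAdapted U X E) (hU : IsOpen U) (hq : q ∈ U)
    (w : ℝ × ℝ) : ∃ c : ℝ,
      fderiv ℝ (nullDir E) q w = (E 0 q 0)⁻¹ • fderiv ℝ (E 0) q w + c • E 0 q := by
  have hd := hE.differentiableAt hU hq 0
  have h0 : DifferentiableAt ℝ (fun q' => (E 0 q' 0)⁻¹) q :=
    (differentiableAt_pi.1 hd 0).inv (hE.time_ne_zero hq)
  have h : HasFDerivAt (nullDir E) _ q := h0.hasFDerivAt.smul hd.hasFDerivAt
  rw [h.fderiv]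
  exact ⟨_, rfl⟩

/-- The time component of `nullDir` is constantly `1`, so its derivative has time component `0`,
whereas that of `e₀` is nonzero. -/
theorem eq_zero_of_fderiv_nullDir (hE : IsZeroAdapted U X E) (hU : IsOpen U) (hq : q ∈ U)
    {w : ℝ × ℝ} {c : ℝ} (h : fderiv ℝ (nullDir E) q w = c • E 0 q) :
    fderiv ℝ (nullDir E) q w = 0 := by
  have hd : DifferentiableAt ℝ (nullDir E) q :=
    (hE.contDiffOn_nullDir.contDiffAt (hU.mem_nhds hq)).differentiableAt (by simp)
  have h1 := hasFDerivAt_pi'.1 hd.hasFDerivAt 0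
  have h2 : (fun x => nullDir E x 0) =ᶠ[nhds q] fun _ => (1 : ℝ) := by
    filter_upwards [hU.mem_nhds hq] with y hy using hE.nullDir_time hy
  have h3 := congrArg (fun L : ℝ × ℝ →L[ℝ] ℝ => L w) (h2.hasFDerivAt_iff.1 h1).fderiv
  have h4 : fderiv ℝ (nullDir E) q w 0 = 0 := by simpa using h3.symm
  rw [h] at h4 ⊢
  have : c = 0 := by simpa [hE.time_ne_zero hq] using h4
  rw [this, zero_smul]

end IsZeroAdapted

/-- When `a₁ = 0`, `de₀` is a multiple of `e₀`, so the normalized null direction `n` is locally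
constant, and `d⟨x, n⟩ = ⟨dx, n⟩ = 0`. The pair `(n, ⟨x, n⟩)` depends only on the point, so it is
the same on all of `S`; the plane is a translate of the orthogonal complement of `n`. -/
theorem inLightlikePlane_of_a1Zero {S : Set Mink} (hS : IsRegularSurface S)
    (hc : IsPreconnected S) (hne : S.Nonempty) (hl : IsLightlike S) (ha : A1Zero S) :
    InLightlikePlane S := by
  let P : Mink → Mink × ℝ → Prop := fun x t => ∃ U X E q, IsLocalParam S U X ∧
    IsZeroAdapted U X E ∧ q ∈ U ∧ X q = x ∧ nullDir E q = t.1 ∧ inn x t.1 = t.2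
  obtain ⟨⟨n, c⟩, h⟩ : ∃ t, ∀ x ∈ S, P x t := by
    refine exists_forall_of_locally hc hne ?_ ?_
    · rintro x - ⟨n, c⟩ ⟨n', c'⟩ ⟨U, X, E, q, hX, hE, hq, hqx, hn, hc⟩
        ⟨V, Y, F, r, hY, hF, hr, hrx, hn', hc'⟩
      have h := hE.eq_smul_of_eq hX hY hF hq hr (hqx.trans hrx.symm)
      have hnn : n = n' := by
        simp only at hn hn'
        have h0 := hE.time_ne_zero hq
        have h0' := hF.time_ne_zero hr
        rw [← hn, ← hn', nullDir, nullDir]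
        conv_lhs => rw [h]
        rw [smul_smul]
        congr 1
        simp only [Pi.smul_apply, smul_eq_mul]
        field_simp
      subst hnn
      simp only at hc hc'
      rw [← hc, ← hc']
    · intro x hx
      obtain ⟨U, X, hX, q, hq, rfl⟩ := hS x hx
      obtain ⟨E, hE⟩ := hX.exists_isZeroAdapted (hl U X hX)
      have hnd : DifferentiableOn ℝ (nullDir E) U :=
        hE.contDiffOn_nullDir.differentiableOn (by simp)
      have hn : ∀ r ∈ U, fderiv ℝ (nullDir E) r = 0 := by
        intro r hr
        refine ContinuousLinearMap.ext fun w => ?_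
        obtain ⟨c, hc⟩ := hE.exists_fderiv_nullDir hX.isOpen hr w
        obtain ⟨d, hd⟩ := (hE.hasA1_iff hX.isOpen hr).1 (ha U X E hX hE r hr) w
        rw [hd, zero_smul, zero_add, smul_smul, ← add_smul] at hc
        exact hE.eq_zero_of_fderiv_nullDir hX.isOpen hr hc
      have hcd : DifferentiableOn ℝ (fun r => inn (X r) (nullDir E r)) U :=
        (contDiffOn_inn hX.smooth hE.contDiffOn_nullDir).differentiableOn (by simp)
      have hc' : ∀ r ∈ U, fderiv ℝ (fun r => inn (X r) (nullDir E r)) r = 0 := by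
        intro r hr
        refine ContinuousLinearMap.ext fun w => ?_
        rw [fderiv_inn_apply (hX.differentiableAt hr)
          ((hnd r hr).differentiableAt (hX.isOpen.mem_nhds hr)), hn r hr, nullDir, inn_smul_right,
          inn_comm, hE.inn_zero_fderiv hr]
        simp [inn_zero_right]
      refine ⟨(nullDir E q, inn (X q) (nullDir E q)), ?_⟩
      filter_upwards [hX.eventually_nhdsWithin hq
        ((eventually_eq_of_fderiv_eq_zero hX.isOpen hnd hn hq).and
          (eventually_eq_of_fderiv_eq_zero hX.isOpen hcd hc' hq))]
      rintro _ ⟨r, hr, rfl, h1, h2⟩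
      refine ⟨U, X, E, r, hX, hE, hr, rfl, h1, ?_⟩
      simp only at h2 ⊢
      rw [← h2, h1]
  obtain ⟨x₀, hx₀⟩ := hne
  obtain ⟨U, X, E, q, hX, hE, hq, -, hn, hc⟩ := h x₀ hx₀
  simp only at hn hc
  have hn0 : n 0 = 1 := hn ▸ hE.nullDir_time hq
  have hnn : inn n n = 0 := hn ▸ hE.inn_nullDir hq
  refine ⟨x₀, LinearMap.ker (innCLM n : Mink →ₗ[ℝ] ℝ), ?_, ⟨n, ?_, ?_, ?_⟩, ?_⟩
  · have hsurj : Function.Surjective (innCLM n : Mink →ₗ[ℝ] ℝ) := by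
      refine LinearMap.surjective_of_ne_zero fun h0 => ?_
      have h1 : inn n ![1, 0, 0] = 0 := congrArg (fun L : Mink →ₗ[ℝ] ℝ => L ![1, 0, 0]) h0
      simp [inn, hn0] at h1
    have := LinearMap.finrank_range_add_finrank_ker (innCLM n : Mink →ₗ[ℝ] ℝ)
    rw [LinearMap.range_eq_top.2 hsurj, finrank_top] at this
    simp at this
    omega
  · exact hnn
  · rintro rfl; simp at hn0
  · exact fun w hw => hw
  · intro x hx
    obtain ⟨_, _, _, _, _, _, _, _, _, hc'⟩ := h x hx
    change inn n (x - x₀) = 0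
    simp only at hc'
    rw [inn_sub_right, inn_comm n x, inn_comm n x₀, hc, hc', sub_self]

/-- Here `e₀ - x` has zero differential and is intrinsic, hence equals a constant `-p`, and `x - p =
e₀` is null. -/
theorem inLightCone_of_a2Zero {S : Set Mink} (hS : IsRegularSurface S)
    (hc : IsPreconnected S) (hne : S.Nonempty) (hl : IsLightlike S) (ha : A1NeZero S)
    (ha' : A2Zero S) : InLightCone S := by
  let P : Mink → Mink → Prop := fun x p => ∃ U X E q, IsLocalParam S U X ∧
    IsOneAdapted U X E ∧ q ∈ U ∧ X q = x ∧ E 0 q - X q = -p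
  obtain ⟨p, h⟩ : ∃ p, ∀ x ∈ S, P x p := by
    refine exists_forall_of_locally hc hne ?_ ?_
    · rintro x - p p' ⟨U, X, E, q, hX, hE, hq, hqx, hn⟩ ⟨V, Y, F, r, hY, hF, hr, hrx, hn'⟩
      have h := hE.eq_of_eq hX hY hF hq hr (hqx.trans hrx.symm)
      rw [h, hqx, ← hrx, hn'] at hn
      exact (neg_injective hn).symm
    · intro x hx
      obtain ⟨U₀, X, hX₀, q, hq₀, rfl⟩ := hS x hx
      obtain ⟨U, E, hq, hX, hE⟩ := exists_isOneAdapted hX₀ (hl U₀ X hX₀) ha hq₀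
      have hd : ∀ r ∈ U, fderiv ℝ (fun r => E 0 r - X r) r = 0 := by
        intro r hr
        refine ContinuousLinearMap.ext fun w => ?_
        have := (hE.hasA2_iff hX.isOpen hr).1 (ha' U X E hX hE r hr) w
        rw [fderiv_fun_sub (hE.1.differentiableAt hX.isOpen hr 0) (hX.differentiableAt hr)]
        simpa using this
      refine ⟨-(E 0 q - X q), ?_⟩
      filter_upwards [hX.eventually_nhdsWithin hq (eventually_eq_of_fderiv_eq_zero hX.isOpen
        (((hE.1.smooth 0).sub hX.smooth).differentiableOn (by simp)) hd hq)]
      rintro _ ⟨r, hr, rfl, h⟩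
      exact ⟨U, X, E, r, hX, hE, hr, rfl, by rw [neg_neg]; exact h⟩
  refine ⟨p, fun x hx => ?_⟩
  obtain ⟨U, X, E, q, hX, hE, hq, rfl, hp⟩ := h x hx
  rw [sub_eq_add_neg, ← hp, add_sub_cancel]
  exact hE.1.inn_zero_zero q hq

/-! ### Ruled form of non-conical surfaces -/

/-- The map `Z = e₀ - x` has `dZ = a₂ ω¹ e₀`, of rank one. Parametrizing its image by its time
component `τ` gives a curve `z` with velocity the normalized null direction `n`, and `x = e₀ - Z` is
then ruled by null lines. -/
theorem exists_ruled_form {S : Set Mink} (hS : IsRegularSurface S) (hl : IsLightlike S)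
    (hnc : IsNonConical S) {p : Mink} (hp : p ∈ S) :
    ∃ (s₀ τ₀ ε : ℝ) (n z : ℝ → Mink), 0 < ε ∧ s₀ ≠ 0 ∧
      ContDiffOn ℝ ∞ n (Metric.ball τ₀ ε) ∧
      (∀ τ ∈ Metric.ball τ₀ ε, HasDerivAt z (n τ) τ) ∧
      (∀ τ ∈ Metric.ball τ₀ ε, inn (n τ) (n τ) = 0) ∧
      (∀ τ ∈ Metric.ball τ₀ ε, 0 < inn (deriv n τ) (deriv n τ)) ∧
      (∀ s ∈ Metric.ball s₀ ε, ∀ τ ∈ Metric.ball τ₀ ε, s • n τ - z τ ∈ S) ∧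
      s₀ • n τ₀ - z τ₀ = p := by
  obtain ⟨U₀, X, hX₀, q₀, hq₀', rfl⟩ := hS p hp
  obtain ⟨U, E, hq₀, hX, hE⟩ := exists_isOneAdapted hX₀ (hl U₀ X hX₀) hnc.1 hq₀'
  have hEz := hE.1
  set Z : ℝ × ℝ → Mink := fun q => E 0 q - X q with hZ
  have hZs : ContDiffOn ℝ ∞ Z U := (hEz.smooth 0).sub hX.smooth
  have hZd : ∀ q ∈ U, ∃ a, a ≠ 0 ∧
      ∀ w, fderiv ℝ Z q w = (a * inn (E 1 q) (fderiv ℝ X q w)) • E 0 q := by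
    intro q hq
    obtain ⟨a, ha, h⟩ := hnc.2 U X E hX hE q hq
    refine ⟨a, ha, fun w => ?_⟩
    rw [hZ, fderiv_fun_sub (hEz.differentiableAt hX.isOpen hq 0) (hX.differentiableAt hq)]
    exact (hE.hasA2_iff hX.isOpen hq).1 h w
  have hE0d : ∀ q ∈ U, ∀ w, ∃ c : ℝ,
      fderiv ℝ (E 0) q w = inn (E 1 q) (fderiv ℝ X q w) • E 1 q + c • E 0 q := by
    intro q hq w
    obtain ⟨c, hc⟩ := (hEz.hasA1_iff hX.isOpen hq).1 (hE.2 q hq) w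
    refine ⟨inn (E 2 q) (fderiv ℝ X q w) + c, ?_⟩
    have h := hEz.expand hq (fderiv ℝ X q w)
    rw [hEz.inn_zero_fderiv hq] at h
    rw [hc]
    conv_lhs => rw [h]
    module
  -- These two time components are coordinates: `dZ⁰ = a₂ ω¹ e₀⁰` detects `ω¹`, and where `ω¹`
  -- vanishes `de₀` is a multiple of `e₀`, detected by its time component.
  set Ψ : ℝ × ℝ → ℝ × ℝ := fun q => (E 0 q 0, Z q 0) with hΨ
  have hΨs : ContDiffOn ℝ ∞ Ψ U :=
    (contDiffOn_pi.1 (hEz.smooth 0) 0).prodMk (contDiffOn_pi.1 hZs 0)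
  have hZdiff : ∀ q ∈ U, DifferentiableAt ℝ Z q := fun q hq =>
    (hZs.contDiffAt (hX.isOpen.mem_nhds hq)).differentiableAt (by simp)
  have hΨd : ∀ q ∈ U, ∀ w, fderiv ℝ Ψ q w = (fderiv ℝ (E 0) q w 0, fderiv ℝ Z q w 0) := by
    intro q hq w
    have h1 := hasFDerivAt_pi'.1 (hEz.differentiableAt hX.isOpen hq 0).hasFDerivAt 0
    have h2 := hasFDerivAt_pi'.1 (hZdiff q hq).hasFDerivAt 0
    have : HasFDerivAt Ψ _ q := h1.prodMk h2
    rw [this.fderiv]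
    rfl
  have hinj : Function.Injective (fderiv ℝ Ψ q₀) := by
    rw [injective_iff_map_eq_zero]
    intro w hw
    rw [hΨd q₀ hq₀, Prod.mk_eq_zero] at hw
    obtain ⟨a, ha, hZa⟩ := hZd q₀ hq₀
    have h0 := hEz.time_ne_zero hq₀
    have h1 : inn (E 1 q₀) (fderiv ℝ X q₀ w) = 0 := by
      have := hw.2
      rw [hZa w] at this
      simpa [ha, h0] using this
    have h2 : fderiv ℝ Z q₀ w = 0 := by rw [hZa w, h1]; simp
    obtain ⟨c, hc⟩ := hE0d q₀ hq₀ w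
    rw [h1, zero_smul, zero_add] at hc
    have h3 : c = 0 := by
      have := hw.1
      rw [hc] at this
      simpa [h0] using this
    have h4 : fderiv ℝ X q₀ w = 0 := by
      rw [hZ, fderiv_fun_sub (hEz.differentiableAt hX.isOpen hq₀ 0)
        (hX.differentiableAt hq₀)] at h2
      rw [sub_apply, hc, h3, zero_smul, zero_sub, neg_eq_zero] at h2
      exact h2
    exact (injective_iff_map_eq_zero _).1 (hX.immersion q₀ hq₀) w h4
  obtain ⟨e, hqe, heU, he, hes⟩ := exists_smooth_inverse hX.isOpen hΨs hq₀ hinj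
  obtain ⟨ε, hε, hball⟩ := Metric.isOpen_iff.1 e.open_target (e q₀) (e.map_source hqe)
  set s₀ : ℝ := E 0 q₀ 0 with hs₀
  set τ₀ : ℝ := Z q₀ 0 with hτ₀
  have heq₀ : e q₀ = (s₀, τ₀) := he q₀
  have hbox : ∀ s ∈ Metric.ball s₀ ε, ∀ τ ∈ Metric.ball τ₀ ε, (s, τ) ∈ e.target := by
    intro s hs τ hτ
    apply hball
    rw [heq₀, ← ball_prod_same]
    exact ⟨hs, hτ⟩
  have hσU : ∀ x ∈ e.target, e.symm x ∈ U := fun x hx => heU (e.map_target hx)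
  have hΨσ : ∀ x ∈ e.target, E 0 (e.symm x) 0 = x.1 ∧ Z (e.symm x) 0 = x.2 := by
    intro x hx
    have : Ψ (e.symm x) = x := by rw [← he, e.right_inv hx]
    exact Prod.ext_iff.1 this
  have hσd : ∀ x ∈ e.target, DifferentiableAt ℝ e.symm x := fun x hx =>
    (hes.contDiffAt (e.open_target.mem_nhds hx)).differentiableAt (by simp)
  have hΨL : ∀ x ∈ e.target, ∀ w,
      fderiv ℝ Z (e.symm x) (fderiv ℝ e.symm x w) 0 = w.2 := by
    intro x hx w
    have hU := hσU x hx
    have h1 : HasFDerivAt (fun y => Z (e.symm y) 0) _ x :=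
      hasFDerivAt_pi'.1 ((hZdiff _ hU).hasFDerivAt.comp x (hσd x hx).hasFDerivAt) 0
    have h2 : (fun y => Z (e.symm y) 0) =ᶠ[nhds x] fun y => y.2 := by
      filter_upwards [e.open_target.mem_nhds hx] with y hy using (hΨσ y hy).2
    have h3 := (h2.hasFDerivAt_iff.1 h1).unique hasFDerivAt_snd
    exact congrArg (fun L : ℝ × ℝ →L[ℝ] ℝ => L w) h3
  set ν : ℝ × ℝ → Mink := fun x => nullDir E (e.symm x) with hν
  set ζ : ℝ × ℝ → Mink := fun x => Z (e.symm x) with hζ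
  have hνs : ContDiffOn ℝ ∞ ν e.target := hEz.contDiffOn_nullDir.comp hes hσU
  -- `dζ` is a multiple of the null direction, and its time component is `dτ`; since `ν` has time
  -- component `1`, the multiple is `dτ`.
  have hζd : ∀ x ∈ e.target, ∀ w, fderiv ℝ ζ x w = w.2 • ν x := by
    intro x hx w
    have hU := hσU x hx
    have h1 : HasFDerivAt ζ _ x := (hZdiff _ hU).hasFDerivAt.comp x (hσd x hx).hasFDerivAt
    obtain ⟨a, ha, hZa⟩ := hZd _ hU
    have h2 := hΨL x hx w
    rw [hZa] at h2
    rw [h1.fderiv, ContinuousLinearMap.comp_apply, hZa, ← h2, hν]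
    simp only [Pi.smul_apply, smul_eq_mul, ← smul_smul, hEz.smul_nullDir hU]
  -- Along `s` the vector `ν` does not change, because a multiple of `e₀` with zero time component
  -- vanishes. Along `τ` it has a nonzero `e₁`-component, which makes `⟨n', n'⟩` positive.
  have hνd : ∀ x ∈ e.target, ∀ w, ∃ k c : ℝ, k ≠ 0 ∧
      fderiv ℝ ν x w = (w.2 * k) • E 1 (e.symm x) + c • E 0 (e.symm x) ∧
      (w.2 = 0 → fderiv ℝ ν x w = 0) := by
    intro x hx w
    have hU := hσU x hx
    have hnd : DifferentiableAt ℝ (nullDir E) (e.symm x) :=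
      (hEz.contDiffOn_nullDir.contDiffAt (hX.isOpen.mem_nhds hU)).differentiableAt (by simp)
    have h1 : HasFDerivAt ν _ x := hnd.hasFDerivAt.comp x (hσd x hx).hasFDerivAt
    obtain ⟨a, ha, hZa⟩ := hZd _ hU
    have h2 := hΨL x hx w
    rw [hZa] at h2
    simp only [Pi.smul_apply, smul_eq_mul] at h2
    obtain ⟨c₁, hc₁⟩ := hEz.exists_fderiv_nullDir hX.isOpen hU (fderiv ℝ e.symm x w)
    obtain ⟨c₂, hc₂⟩ := hE0d _ hU (fderiv ℝ e.symm x w)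
    have h0 := hEz.time_ne_zero hU
    set t := E 0 (e.symm x) 0
    set m := inn (E 1 (e.symm x)) (fderiv ℝ X (e.symm x) (fderiv ℝ e.symm x w))
    have h3 : t⁻¹ * m = w.2 * (t⁻¹ * (a * t)⁻¹) := by
      rw [← h2]; field_simp
    have h4 : fderiv ℝ ν x w = (w.2 * (t⁻¹ * (a * t)⁻¹)) • E 1 (e.symm x) +
        (t⁻¹ * c₂ + c₁) • E 0 (e.symm x) := by
      rw [h1.fderiv, ContinuousLinearMap.comp_apply, hc₁, hc₂, ← h3]
      module
    refine ⟨t⁻¹ * (a * t)⁻¹, t⁻¹ * c₂ + c₁, ?_, h4, fun hw => ?_⟩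
    · exact mul_ne_zero (inv_ne_zero h0) (inv_ne_zero (mul_ne_zero ha h0))
    · rw [hw, zero_mul, zero_smul, zero_add, h1.fderiv, ContinuousLinearMap.comp_apply] at h4
      rw [h1.fderiv, ContinuousLinearMap.comp_apply]
      exact hEz.eq_zero_of_fderiv_nullDir hX.isOpen hU h4
  have hνdiff : ∀ x ∈ e.target, DifferentiableAt ℝ ν x := fun x hx =>
    (hνs.contDiffAt (e.open_target.mem_nhds hx)).differentiableAt (by simp)
  have hζdiff : ∀ x ∈ e.target, DifferentiableAt ℝ ζ x := fun x hx =>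
    (hZdiff _ (hσU x hx)).comp x (hσd x hx)
  have hconst : ∀ g : ℝ × ℝ → Mink, (∀ x ∈ e.target, DifferentiableAt ℝ g x) →
      (∀ x ∈ e.target, fderiv ℝ g x (1, 0) = 0) → ∀ s ∈ Metric.ball s₀ ε,
      ∀ τ ∈ Metric.ball τ₀ ε, g (s, τ) = g (s₀, τ) := by
    intro g hg hg' s hs τ hτ
    have hd : ∀ t ∈ Metric.ball s₀ ε, HasDerivAt (fun t => g (t, τ)) 0 t := by
      intro t ht
      have hx := hbox t ht τ hτ
      have h1 : HasDerivAt (fun t : ℝ => (t, τ)) (1, 0) t :=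
        (hasDerivAt_id t).prodMk (hasDerivAt_const t τ)
      have := (hg _ hx).hasFDerivAt.comp_hasDerivAt t h1
      rwa [hg' _ hx] at this
    exact Metric.isOpen_ball.is_const_of_deriv_eq_zero (convex_ball s₀ ε).isPreconnected
      (fun t ht => (hd t ht).differentiableAt.differentiableWithinAt)
      (fun t ht => (hd t ht).deriv) hs (Metric.mem_ball_self hε)
  have hνc := hconst ν hνdiff fun x hx => (hνd x hx (1, 0)).elim fun k h => by
    obtain ⟨c, -, -, h⟩ := h
    exact h rfl
  have hζc := hconst ζ hζdiff fun x hx => by rw [hζd x hx]; simp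
  have hs₀b := Metric.mem_ball_self (x := s₀) hε
  have hline : ∀ τ : ℝ, HasDerivAt (fun t : ℝ => (s₀, t)) ((0, 1) : ℝ × ℝ) τ := fun τ =>
    (hasDerivAt_const τ s₀).prodMk (hasDerivAt_id τ)
  have hpt : ∀ x ∈ e.target, x.1 • ν x - ζ x = X (e.symm x) := by
    intro x hx
    rw [← (hΨσ x hx).1, hν, hζ, hZ]
    simp only [hEz.smul_nullDir (hσU x hx)]
    abel
  refine ⟨s₀, τ₀, ε, fun τ => ν (s₀, τ), fun τ => ζ (s₀, τ), hε, hEz.time_ne_zero hq₀,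
    ?_, ?_, ?_, ?_, ?_, ?_⟩
  · exact hνs.comp (contDiff_const.prodMk contDiff_id).contDiffOn fun τ hτ => hbox _ hs₀b τ hτ
  · intro τ hτ
    have hx := hbox _ hs₀b τ hτ
    have := (hζdiff _ hx).hasFDerivAt.comp_hasDerivAt τ (hline τ)
    rw [hζd _ hx, one_smul] at this
    exact this
  · exact fun τ hτ => hEz.inn_nullDir (hσU _ (hbox _ hs₀b τ hτ))
  · intro τ hτ
    have hx := hbox _ hs₀b τ hτ
    have h := (hνdiff _ hx).hasFDerivAt.comp_hasDerivAt τ (hline τ)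
    have hd : deriv (fun τ => ν (s₀, τ)) τ = _ := h.deriv
    obtain ⟨k, c, hk, hkc, -⟩ := hνd _ hx (0, 1)
    have hU := hσU _ hx
    rw [hd, hkc]
    simp only [inn_add_left, inn_add_right, inn_smul_left, inn_smul_right,
      hEz.inn_zero_zero _ hU, hEz.inn_zero_one _ hU, hEz.inn_one_one _ hU,
      inn_comm (E 1 _) (E 0 _)]
    have : 0 < k ^ 2 := by positivity
    nlinarith
  · intro s hs τ hτ
    have hx := hbox s hs τ hτ
    have := hpt _ hx
    rw [hνc s hs τ hτ, hζc s hs τ hτ] at this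
    simp only at this ⊢
    rw [this]
    exact hX.mapsTo (hσU _ hx)
  · have hx := hbox _ hs₀b _ (Metric.mem_ball_self (x := τ₀) hε)
    have := hpt _ hx
    simp only at this ⊢
    rw [this, ← heq₀, e.left_inv hqe]

/-- A smooth curve on the light cone, parametrized by arc length. -/
structure IsNullCurve (I : Set ℝ) (G : ℝ → Mink) : Prop where
  smooth : ContDiffOn ℝ ∞ G I
  null : ∀ v ∈ I, inn (G v) (G v) = 0
  unit : ∀ v ∈ I, inn (deriv G v) (deriv G v) = 1

/-- The map `(u, v) ↦ e^u G(v) - ∫₀^v G(τ) dτ - c`. -/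
noncomputable def ruled (G : ℝ → Mink) (c : Mink) (q : ℝ × ℝ) : Mink :=
  Real.exp q.1 • G q.2 - (∫ τ in (0 : ℝ)..q.2, G τ) - c

theorem contDiffOn_of_hasDerivAt {F : Type*} [NormedAddCommGroup F] [NormedSpace ℝ F] {I : Set ℝ}
    (hI : IsOpen I) {f f' : ℝ → F} (hf' : ContDiffOn ℝ ∞ f' I)
    (h : ∀ t ∈ I, HasDerivAt f (f' t) t) : ContDiffOn ℝ ∞ f I := by
  rw [contDiffOn_infty_iff_deriv_of_isOpen hI]
  exact ⟨fun t ht => (h t ht).differentiableAt.differentiableWithinAt,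
    hf'.congr fun t ht => (h t ht).deriv⟩

theorem hasDerivAt_primitive {F : Type*} [NormedAddCommGroup F] [NormedSpace ℝ F] [CompleteSpace F]
    {I : Set ℝ} (hI : IsOpen I) (hc : I.OrdConnected) {f : ℝ → F} (hf : ContinuousOn f I)
    {a t : ℝ} (ha : a ∈ I) (ht : t ∈ I) : HasDerivAt (fun t => ∫ s in a..t, f s) (f t) t :=
  intervalIntegral.integral_hasDerivAt_right
    ((hf.mono (hc.uIcc_subset ha ht)).intervalIntegrable)
    (hf.stronglyMeasurableAtFilter hI t ht) (hf.continuousAt (hI.mem_nhds ht))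

/-- Take `G(v) = k n(T(v))` with `T' = k(T)`. The same factor `k` makes `z ∘ T` a primitive of `G`,
and `G' ≡ k² n'` modulo `n`, so `⟨G', G'⟩ = k⁴ ⟨n', n'⟩`. Unit speed thus determines `k` up to sign.
-/
theorem exists_ruled_nullCurve {S : Set Mink} (hS : IsRegularSurface S) (hl : IsLightlike S)
    (hnc : IsNonConical S) {p : Mink} (hp : p ∈ S) :
    ∃ (δ u₀ : ℝ) (G : ℝ → Mink) (c : Mink) (W : Set (ℝ × ℝ)), 0 < δ ∧
      IsNullCurve (Metric.ball 0 δ) G ∧ IsOpen W ∧ (∀ q ∈ W, q.2 ∈ Metric.ball (0 : ℝ) δ) ∧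
      (u₀, (0 : ℝ)) ∈ W ∧ Set.MapsTo (ruled G c) W S ∧ ruled G c (u₀, 0) = p := by
  obtain ⟨s₀, τ₀, ε, n, z, hε, hs₀, hn, hz, hnn, hn', hmem, hp⟩ := exists_ruled_form hS hl hnc hp
  set J := Metric.ball τ₀ ε with hJ
  have hJo : IsOpen J := Metric.isOpen_ball
  have hJc : J.OrdConnected := (convex_ball τ₀ ε).ordConnected
  have hτ₀ : τ₀ ∈ J := Metric.mem_ball_self hε
  have hnd : ContDiffOn ℝ ∞ (deriv n) J := hn.deriv_of_isOpen hJo (by simp)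
  set r : ℝ → ℝ := fun τ => √√(inn (deriv n τ) (deriv n τ)) with hr
  have hr0 : ∀ τ ∈ J, 0 < r τ := fun τ hτ => Real.sqrt_pos.2 (Real.sqrt_pos.2 (hn' τ hτ))
  have hr4 : ∀ τ ∈ J, r τ ^ 4 = inn (deriv n τ) (deriv n τ) := by
    intro τ hτ
    rw [hr, show 4 = 2 * 2 from rfl, pow_mul, Real.sq_sqrt (Real.sqrt_nonneg _),
      Real.sq_sqrt (hn' τ hτ).le]
  have hrs : ContDiffOn ℝ ∞ r J :=
    ((contDiffOn_inn hnd hnd).sqrt fun τ hτ => (hn' τ hτ).ne').sqrt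
      fun τ hτ => (Real.sqrt_pos.2 (hn' τ hτ)).ne'
  -- The sign of `k` is that of `s₀`, so that `s₀ = e^u k` can be solved for `u`.
  obtain ⟨σ, hσ2, hσs⟩ : ∃ σ : ℝ, σ * σ = 1 ∧ 0 < σ * s₀ := by
    rcases lt_or_gt_of_ne hs₀ with h | h
    · exact ⟨-1, by norm_num, by linarith⟩
    · exact ⟨1, by norm_num, by linarith⟩
  have hσ0 : σ ≠ 0 := by rintro rfl; simp at hσ2
  set k : ℝ → ℝ := fun τ => σ / r τ with hk
  have hk0 : ∀ τ ∈ J, k τ ≠ 0 := fun τ hτ => div_ne_zero hσ0 (hr0 τ hτ).ne'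
  have hks : ContDiffOn ℝ ∞ k J := contDiffOn_const.div hrs fun τ hτ => (hr0 τ hτ).ne'
  have hk4 : ∀ τ ∈ J, k τ ^ 4 * inn (deriv n τ) (deriv n τ) = 1 := by
    intro τ hτ
    have := (hr0 τ hτ).ne'
    rw [hk, ← hr4 τ hτ]
    field_simp
    calc σ ^ 4 = (σ * σ) * (σ * σ) := by ring
      _ = 1 := by rw [hσ2]; norm_num
  have hkis : ContDiffOn ℝ ∞ (fun τ => (k τ)⁻¹) J := hks.inv hk0
  -- `R' = 1 / k`, so the inverse of `R` is the change of parameter `T` with `T' = k(T)` and `T(0) =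
  -- τ₀`.
  set R : ℝ → ℝ := fun τ => ∫ t in τ₀..τ, (k t)⁻¹ with hR
  have hRd : ∀ τ ∈ J, HasDerivAt R (k τ)⁻¹ τ := fun τ hτ =>
    hasDerivAt_primitive hJo hJc hkis.continuousOn hτ₀ hτ
  have hRs : ContDiffOn ℝ ∞ R J := contDiffOn_of_hasDerivAt hJo hkis hRd
  obtain ⟨e, hτe, heJ, he, hes⟩ := exists_smooth_inverse hJo hRs hτ₀ (by
    rw [(hRd τ₀ hτ₀).hasFDerivAt.fderiv, injective_iff_map_eq_zero]
    intro x hx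
    simpa [hk0 τ₀ hτ₀] using hx)
  have heτ : e τ₀ = 0 := by rw [he, hR]; simp
  obtain ⟨δ, hδ, hball⟩ := Metric.isOpen_iff.1 e.open_target 0 (heτ ▸ e.map_source hτe)
  set I := Metric.ball (0 : ℝ) δ with hI
  have hIo : IsOpen I := Metric.isOpen_ball
  have hIc : I.OrdConnected := (convex_ball 0 δ).ordConnected
  have h0I : (0 : ℝ) ∈ I := Metric.mem_ball_self hδ
  set T : ℝ → ℝ := fun v => e.symm v with hT
  have hTJ : ∀ v ∈ I, T v ∈ J := fun v hv => heJ (e.map_target (hball hv))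
  have hT0 : T 0 = τ₀ := by simp only [hT]; rw [← heτ, e.left_inv hτe]
  have hTd : ∀ v ∈ I, HasDerivAt T (k (T v)) v := by
    intro v hv
    have h1 : HasDerivAt e (k (T v))⁻¹ (T v) :=
      (hRd _ (hTJ v hv)).congr_of_eventuallyEq (Filter.Eventually.of_forall he)
    have := e.hasDerivAt_symm (hball hv) (inv_ne_zero (hk0 _ (hTJ v hv))) h1
    rwa [inv_inv] at this
  have hTs : ContDiffOn ℝ ∞ T I := hes.mono hball
  set G : ℝ → Mink := fun v => k (T v) • n (T v) with hG
  have hGs : ContDiffOn ℝ ∞ G I := (hks.comp hTs hTJ).smul (hn.comp hTs hTJ)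
  have hndiff : ∀ τ ∈ J, HasDerivAt n (deriv n τ) τ := fun τ hτ =>
    ((hn.contDiffAt (hJo.mem_nhds hτ)).differentiableAt (by simp)).hasDerivAt
  have hkdiff : ∀ τ ∈ J, HasDerivAt k (deriv k τ) τ := fun τ hτ =>
    ((hks.contDiffAt (hJo.mem_nhds hτ)).differentiableAt (by simp)).hasDerivAt
  have hnn' : ∀ τ ∈ J, inn (n τ) (deriv n τ) = 0 := by
    intro τ hτ
    have h1 := hasDerivAt_inn (hndiff τ hτ) (hndiff τ hτ)
    have h2 : (fun t => inn (n t) (n t)) =ᶠ[nhds τ] fun _ => (0 : ℝ) := by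
      filter_upwards [hJo.mem_nhds hτ] with t ht using hnn t ht
    have h3 := (h2.hasDerivAt_iff.1 h1).unique (hasDerivAt_const τ 0)
    rw [inn_comm (deriv n τ)] at h3
    linarith
  have hzT : ∀ v ∈ I, HasDerivAt (fun v => z (T v)) (G v) v := fun v hv =>
    (hz _ (hTJ v hv)).scomp v (hTd v hv)
  have hint : ∀ v ∈ I, ∫ t in (0 : ℝ)..v, G t = z (T v) - z τ₀ := by
    intro v hv
    have hsub := hIc.uIcc_subset h0I hv
    rw [intervalIntegral.integral_eq_sub_of_hasDerivAt (fun t ht => hzT t (hsub ht))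
      (hGs.continuousOn.mono hsub).intervalIntegrable, hT0]
  have hruled : ∀ q : ℝ × ℝ, q.2 ∈ I →
      ruled G (z τ₀) q = (Real.exp q.1 * k (T q.2)) • n (T q.2) - z (T q.2) := by
    intro q hq
    rw [ruled, hint _ hq, hG, smul_smul]
    abel
  have hpos : 0 < s₀ / k τ₀ := by
    have h1 := hr0 τ₀ hτ₀
    have : s₀ / k τ₀ = (σ * s₀) * r τ₀ := by
      rw [hk]; simp only; rw [div_div_eq_mul_div, div_eq_iff hσ0]
      linear_combination (-(s₀ * r τ₀)) * hσ2
    rw [this]; positivity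
  have hu₀ : Real.exp (Real.log (s₀ / k τ₀)) * k (T 0) = s₀ := by
    rw [Real.exp_log hpos, hT0, div_mul_cancel₀ _ (hk0 τ₀ hτ₀)]
  -- `Φ` is the old ruling coordinate `s` in terms of `(u, v)`; the domain is where it stays in the
  -- range covered by the ruled form.
  set Φ : ℝ × ℝ → ℝ := fun q => Real.exp q.1 * k (T q.2) with hΦ
  have hVo : IsOpen (Prod.snd ⁻¹' I : Set (ℝ × ℝ)) := hIo.preimage continuous_snd
  have hΦc : ContinuousOn Φ (Prod.snd ⁻¹' I) :=
    (Real.continuous_exp.comp continuous_fst).continuousOn.mul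
      ((hks.comp hTs hTJ).continuousOn.comp continuous_snd.continuousOn fun q hq => hq)
  refine ⟨δ, Real.log (s₀ / k τ₀), G, z τ₀, Prod.snd ⁻¹' I ∩ Φ ⁻¹' Metric.ball s₀ ε, hδ,
    ⟨hGs, ?_, ?_⟩, hΦc.isOpen_inter_preimage hVo Metric.isOpen_ball, fun q hq => hq.1,
    ⟨h0I, ?_⟩, ?_, ?_⟩
  · intro v hv
    rw [hG, inn_smul_left, inn_smul_right, hnn _ (hTJ v hv)]
    simp
  · intro v hv
    have hτ := hTJ v hv
    have h1 : HasDerivAt G _ v := ((hkdiff _ hτ).comp v (hTd v hv)).smul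
      ((hndiff _ hτ).scomp v (hTd v hv))
    rw [h1.deriv]
    simp only [Function.comp_apply, inn_add_left, inn_add_right, inn_smul_left, inn_smul_right,
      hnn _ hτ, hnn' _ hτ, inn_comm (deriv n (T v)) (n (T v))]
    linear_combination hk4 _ hτ
  · change Φ _ ∈ Metric.ball s₀ ε
    rw [hΦ]
    simp only
    rw [hu₀]
    exact Metric.mem_ball_self hε
  · rintro q ⟨hq, hqΦ⟩
    rw [hruled q hq]
    exact hmem _ hqΦ _ (hTJ _ hq)
  · rw [hruled _ h0I]
    simp only
    rw [hu₀, hT0, hp]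

/-! ### Null curves -/

theorem iteratedDeriv_two_eq (G : ℝ → Mink) : iteratedDeriv 2 G = deriv (deriv G) := by
  rw [iteratedDeriv_succ, iteratedDeriv_one]

theorem iteratedDeriv_three_eq (G : ℝ → Mink) : iteratedDeriv 3 G = deriv (deriv (deriv G)) := by
  rw [iteratedDeriv_succ, iteratedDeriv_two_eq]

/-- The Gram matrix of `(G, G', G'')` for a null curve `G` parametrized by arc length. -/
structure IsGram (f : ℝ) (a b c : Mink) : Prop where
  aa : inn a a = 0
  ab : inn a b = 0
  ac : inn a c = -1
  bb : inn b b = 1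
  bc : inn b c = 0
  cc : inn c c = -2 * f

namespace IsGram

variable {f : ℝ} {a b c : Mink}

theorem eq_zero (h : IsGram f a b c) {x : Mink} (ha : inn x a = 0) (hb : inn x b = 0)
    (hc : inn x c = 0) : x = 0 := by
  refine eq_zero_of_gram ?_ ha hb hc
  rw [h.aa, h.ab, h.ac, h.bb, h.bc, h.cc]
  norm_num

theorem inn_comb (h : IsGram f a b c) (α β γ α' β' γ' : ℝ) :
    inn (α • a + β • b + γ • c) (α' • a + β' • b + γ' • c) =
      -(α * γ' + γ * α') + β * β' - 2 * f * γ * γ' := by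
  simp only [inn_add_left, inn_add_right, inn_smul_left, inn_smul_right, h.aa, h.ab, h.ac, h.bb,
    h.bc, h.cc, inn_comm b a, inn_comm c a, inn_comm c b]
  ring

theorem expand (h : IsGram f a b c) (v : Mink) :
    v = (-inn v c + 2 * f * inn v a) • a + inn v b • b + (-inn v a) • c := by
  rw [← sub_eq_zero]
  apply h.eq_zero <;>
  · simp only [inn_sub_left, inn_add_left, inn_smul_left, h.aa, h.ab, h.ac, h.bb,
      h.bc, h.cc, inn_comm b a, inn_comm c a, inn_comm c b]
    ring

/-- The linear map carrying one basis to the other is written with the coordinates of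
`IsGram.expand`. It preserves inner products because these depend only on coordinates and the Gram
matrix. -/
theorem exists_isometry (h : IsGram f a b c) {a' b' c' : Mink} (h' : IsGram f a' b' c') :
    ∃ A : Matrix (Fin 3) (Fin 3) ℝ, (∀ v w : Mink, inn (A *ᵥ v) (A *ᵥ w) = inn v w) ∧
      A *ᵥ a = a' ∧ A *ᵥ b = b' ∧ A *ᵥ c = c' := by
  let T : Mink →ₗ[ℝ] Mink :=
    { toFun := fun v => (-inn v c + 2 * f * inn v a) • a' + inn v b • b' + (-inn v a) • c'
      map_add' := fun v w => by simp only [inn_add_left]; module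
      map_smul' := fun r v => by simp only [inn_smul_left, RingHom.id_apply]; module }
  have hT : ∀ v, LinearMap.toMatrix' T *ᵥ v =
      (-inn v c + 2 * f * inn v a) • a' + inn v b • b' + (-inn v a) • c' :=
    fun v => LinearMap.toMatrix'_mulVec T v
  refine ⟨LinearMap.toMatrix' T, fun v w => ?_, ?_, ?_, ?_⟩
  · rw [hT, hT, h'.inn_comb]
    conv_rhs => rw [h.expand v, h.expand w]
    rw [h.inn_comb]
  all_goals
    rw [hT]
    simp [h.aa, h.ab, h.ac, h.bb, h.bc, h.cc, inn_comm b a, inn_comm c a, inn_comm c b]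

end IsGram

theorem inn_deriv_add_eq_zero {I : Set ℝ} (hI : IsOpen I) {f g f' g' : ℝ → Mink} {c : ℝ}
    (hf : ∀ t ∈ I, HasDerivAt f (f' t) t) (hg : ∀ t ∈ I, HasDerivAt g (g' t) t)
    (h : ∀ t ∈ I, inn (f t) (g t) = c) : ∀ t ∈ I, inn (f' t) (g t) + inn (f t) (g' t) = 0 := by
  intro t ht
  have h2 : (fun t => inn (f t) (g t)) =ᶠ[nhds t] fun _ => c := by
    filter_upwards [hI.mem_nhds ht] with s hs using h s hs
  exact (h2.hasDerivAt_iff.1 (hasDerivAt_inn (hf t ht) (hg t ht))).unique (hasDerivAt_const t c)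

theorem hasDerivAt_of_contDiffOn {F : Type*} [NormedAddCommGroup F] [NormedSpace ℝ F] {I : Set ℝ}
    (hI : IsOpen I) {f : ℝ → F} {n : WithTop ℕ∞} (hn : n ≠ 0) (hf : ContDiffOn ℝ n f I) :
    ∀ t ∈ I, HasDerivAt f (deriv f t) t := fun _ ht =>
  ((hf.contDiffAt (hI.mem_nhds ht)).differentiableAt hn).hasDerivAt

namespace IsNullCurve

variable {I : Set ℝ} {G : ℝ → Mink}

theorem smooth_one (hG : IsNullCurve I G) (hI : IsOpen I) : ContDiffOn ℝ ∞ (deriv G) I :=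
  hG.smooth.deriv_of_isOpen hI (by simp)

theorem smooth_two (hG : IsNullCurve I G) (hI : IsOpen I) : ContDiffOn ℝ ∞ (deriv (deriv G)) I :=
  (hG.smooth_one hI).deriv_of_isOpen hI (by simp)

theorem hasDerivAt_zero (hG : IsNullCurve I G) (hI : IsOpen I) :
    ∀ t ∈ I, HasDerivAt G (deriv G t) t :=
  hasDerivAt_of_contDiffOn hI (by simp) hG.smooth

theorem hasDerivAt_one (hG : IsNullCurve I G) (hI : IsOpen I) :
    ∀ t ∈ I, HasDerivAt (deriv G) (deriv (deriv G) t) t :=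
  hasDerivAt_of_contDiffOn hI (by simp) (hG.smooth_one hI)

theorem hasDerivAt_two (hG : IsNullCurve I G) (hI : IsOpen I) :
    ∀ t ∈ I, HasDerivAt (deriv (deriv G)) (deriv (deriv (deriv G)) t) t :=
  hasDerivAt_of_contDiffOn hI (by simp) (hG.smooth_two hI)

/-- All entries but the last come from differentiating `⟨G, G⟩ = 0` twice and `⟨G', G'⟩ = 1` once.
-/
theorem isGram (hG : IsNullCurve I G) (hI : IsOpen I) {t f : ℝ} (ht : t ∈ I)
    (hf : inn (deriv (deriv G) t) (deriv (deriv G) t) = -2 * f) :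
    IsGram f (G t) (deriv G t) (deriv (deriv G) t) := by
  have h01 : ∀ t ∈ I, inn (G t) (deriv G t) = 0 := by
    intro t ht
    have := inn_deriv_add_eq_zero hI (hG.hasDerivAt_zero hI) (hG.hasDerivAt_zero hI) hG.null t ht
    rw [inn_comm (deriv G t)] at this
    linarith
  have h02 := inn_deriv_add_eq_zero hI (hG.hasDerivAt_zero hI) (hG.hasDerivAt_one hI) h01 t ht
  have h12 := inn_deriv_add_eq_zero hI (hG.hasDerivAt_one hI) (hG.hasDerivAt_one hI) hG.unit t ht
  rw [hG.unit t ht] at h02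
  rw [inn_comm (deriv (deriv G) t)] at h12
  exact ⟨hG.null t ht, h01 t ht, by linarith, hG.unit t ht, by linarith, hf⟩

/-- Differentiating the Gram entries gives the products of `G'''` with `G`, `G'`, `G''` as `0`, `2
f`, `-f'`. These are also the products of `2 f G' + f' G` with this basis. -/
theorem ode (hG : IsNullCurve I G) (hI : IsOpen I) {f : ℝ → ℝ}
    (hf : ∀ t ∈ I, inn (deriv (deriv G) t) (deriv (deriv G) t) = -2 * f t) :
    ∀ t ∈ I, iteratedDeriv 3 G t - (2 * f t) • deriv G t - deriv f t • G t = 0 := by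
  intro t ht
  have hgr := fun s hs => hG.isGram hI hs (hf s hs)
  have h30 := inn_deriv_add_eq_zero hI (hG.hasDerivAt_zero hI) (hG.hasDerivAt_two hI)
    (fun s hs => (hgr s hs).ac) t ht
  have h31 := inn_deriv_add_eq_zero hI (hG.hasDerivAt_one hI) (hG.hasDerivAt_two hI)
    (fun s hs => (hgr s hs).bc) t ht
  have hfd : HasDerivAt f (-inn (deriv (deriv (deriv G)) t) (deriv (deriv G) t)) t := by
    have h := (hasDerivAt_inn (hG.hasDerivAt_two hI t ht)
      (hG.hasDerivAt_two hI t ht)).const_mul (-1 / 2 : ℝ)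
    have h2 : f =ᶠ[nhds t] fun s => (-1 / 2 : ℝ) * inn (deriv (deriv G) s) (deriv (deriv G) s) := by
      filter_upwards [hI.mem_nhds ht] with s hs
      rw [hf s hs]; ring
    refine (h.congr_of_eventuallyEq h2).congr_deriv ?_
    rw [inn_comm (deriv (deriv G) t)]; ring
  have g := hgr t ht
  rw [g.bc] at h30
  rw [g.cc] at h31
  rw [iteratedDeriv_three_eq, hfd.deriv]
  have e1 : inn (deriv (deriv (deriv G)) t) (G t) = 0 := by rw [inn_comm]; linarith
  have e2 : inn (deriv (deriv (deriv G)) t) (deriv G t) = 2 * f t := by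
    rw [inn_comm]; linarith
  apply g.eq_zero
  · simp only [inn_sub_left, inn_smul_left, g.aa, g.ab, e1, inn_comm (deriv G t) (G t)]; ring
  · simp only [inn_sub_left, inn_smul_left, g.ab, g.bb, e2]; ring
  · simp only [inn_sub_left, inn_smul_left, g.ac, g.bc]; ring

end IsNullCurve

/-! ### The initial value problem -/

theorem IsSolution.isUniqueSolution {I : Set ℝ} {f : ℝ → ℝ} (hf : IsProfile I f) {G : ℝ → Mink}
    (hG : IsSolution I f G) : IsUniqueSolution I f G := by
  obtain ⟨hI, hIc, h0, hfs⟩ := hf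
  refine ⟨hG, fun H hH => ?_⟩
  let π₁ := ContinuousLinearMap.fst ℝ Mink (Mink × Mink)
  let π₂ := (ContinuousLinearMap.fst ℝ Mink Mink).comp (ContinuousLinearMap.snd ℝ Mink (Mink × Mink))
  let π₃ := (ContinuousLinearMap.snd ℝ Mink Mink).comp (ContinuousLinearMap.snd ℝ Mink (Mink × Mink))
  let A : ℝ → (Mink × Mink × Mink) →L[ℝ] (Mink × Mink × Mink) := fun t =>
    π₂.prod (π₃.prod ((2 * f t) • π₂ + deriv f t • π₁))
  have hA : ContinuousOn A I := by
    have h1 : ContinuousOn f I := hfs.continuousOn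
    have h2 : ContinuousOn (deriv f) I := hfs.continuousOn_deriv_of_isOpen hI (by simp)
    -- Written as constant operators weighted by `1`, `2 f` and `f'`, the companion operator is
    -- visibly continuous.
    have : A = fun t => π₂.prod (π₃.prod 0) +
        ((2 * f t) • (0 : _ →L[ℝ] Mink).prod ((0 : _ →L[ℝ] Mink).prod π₂) +
          deriv f t • (0 : _ →L[ℝ] Mink).prod ((0 : _ →L[ℝ] Mink).prod π₁)) := by
      funext t
      refine ContinuousLinearMap.ext fun w => ?_
      simp [A]
    rw [this]
    fun_prop
  have key : ∀ K : ℝ → Mink, IsSolution I f K → ∀ t ∈ I,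
      HasDerivAt (fun t => (K t, deriv K t, deriv (deriv K) t))
        (A t (K t, deriv K t, deriv (deriv K) t)) t := by
    intro K hK t ht
    have s1 : ContDiffOn ℝ 2 (deriv K) I := hK.contDiffOn.deriv_of_isOpen hI (by norm_num)
    have s2 : ContDiffOn ℝ 1 (deriv (deriv K)) I := s1.deriv_of_isOpen hI (by norm_num)
    have d0 := hasDerivAt_of_contDiffOn hI (by simp) hK.contDiffOn t ht
    have d1 := hasDerivAt_of_contDiffOn hI (by simp) s1 t ht
    have d2 := hasDerivAt_of_contDiffOn hI (by simp) s2 t ht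
    refine (d0.prodMk (d1.prodMk d2)).congr_deriv ?_
    have := hK.ode t ht
    rw [iteratedDeriv_three_eq, sub_sub, sub_eq_zero] at this
    rw [this]
    rfl
  have heq := linear_ode_unique hI hIc hA (key H hH) (key G hG) h0 (by
    have e1 := hH.init_two.trans hG.init_two.symm
    rw [iteratedDeriv_two_eq, iteratedDeriv_two_eq] at e1
    rw [e1, hH.init_one, hG.init_one, hH.init_zero, hG.init_zero])
  exact fun t ht => congrArg Prod.fst (heq ht)

/-- This solves `y'' = (f / 2) y`, whose products of pairs of solutions satisfy `y''' = 2 f y' + f'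
y`. -/
theorem exists_hill_solution {I : Set ℝ} {f : ℝ → ℝ} (hf : IsProfile I f) (y₀ : ℝ × ℝ) :
    ∃ a b : ℝ → ℝ, ContDiffOn ℝ ∞ a I ∧ a 0 = y₀.1 ∧ b 0 = y₀.2 ∧
      (∀ t ∈ I, HasDerivAt a (b t) t) ∧ ∀ t ∈ I, HasDerivAt b (f t / 2 * a t) t := by
  obtain ⟨hI, hIc, h0, hfs⟩ := hf
  let A : ℝ → (ℝ × ℝ) →L[ℝ] (ℝ × ℝ) := fun t =>
    (ContinuousLinearMap.snd ℝ ℝ ℝ).prod 0 +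
      (f t / 2) • (0 : _ →L[ℝ] ℝ).prod (ContinuousLinearMap.fst ℝ ℝ ℝ)
  have hA : ContDiffOn ℝ ∞ A I :=
    contDiffOn_const.add ((hfs.div_const 2).smul contDiffOn_const)
  obtain ⟨Y, hY0, hY⟩ := exists_linear_ode hI hIc hA.continuousOn h0 y₀
  have hYs := contDiffOn_of_linear_ode hI hA hY
  refine ⟨fun t => (Y t).1, fun t => (Y t).2, contDiff_fst.comp_contDiffOn hYs, congrArg Prod.fst hY0,
    congrArg Prod.snd hY0, fun t ht => ?_, fun t ht => ?_⟩
  · have := (hasFDerivAt_fst (𝕜 := ℝ) (p := Y t)).comp_hasDerivAt t (hY t ht)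
    exact this.congr_deriv (by simp [A])
  · have := (hasFDerivAt_snd (𝕜 := ℝ) (p := Y t)).comp_hasDerivAt t (hY t ht)
    exact this.congr_deriv (by simp [A])

/-- In the basis `P, Q, R` the inner product is the discriminant form `β² - α γ`. The curve with
coordinates `(a², a b, b²)` is therefore null, and the square norms of its first and second
derivatives are `w²` and `-2 f w²`, where `w` is the Wronskian, equal to `1`. The differential
equation then follows from `IsNullCurve.ode`. -/
theorem exists_solution {I : Set ℝ} {f : ℝ → ℝ} (hf : IsProfile I f) :
    ∃ G : ℝ → Mink, IsNullCurve I G ∧ IsSolution I f G ∧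
      ∀ t ∈ I, inn (deriv (deriv G) t) (deriv (deriv G) t) = -2 * f t := by
  obtain ⟨a, a', has, ha0, ha0', ha, ha'⟩ := exists_hill_solution hf (1, 0)
  obtain ⟨b, b', hbs, hb0, hb0', hb, hb'⟩ := exists_hill_solution hf (0, 1)
  obtain ⟨hI, hIc, h0, hfs⟩ := hf
  simp only at ha0 ha0' hb0 hb0'
  have hW : ∀ t ∈ I, a t * b' t - a' t * b t = 1 := by
    have hd : ∀ t ∈ I, HasDerivAt (fun t => a t * b' t - a' t * b t) 0 t := by
      intro t ht
      refine (((ha t ht).mul (hb' t ht)).sub ((ha' t ht).mul (hb t ht))).congr_deriv ?_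
      ring
    intro t ht
    rw [hI.is_const_of_deriv_eq_zero hIc.isPreconnected
      (fun t ht => (hd t ht).differentiableAt.differentiableWithinAt)
      (fun t ht => (hd t ht).deriv) ht h0]
    simp [ha0, ha0', hb0, hb0']
  set c : ℝ := 1 / √2 with hc
  have hcc : c * c = 1 / 2 := by
    rw [hc, div_mul_div_comm, Real.mul_self_sqrt (by norm_num)]; norm_num
  -- With `a = 1, a' = 0, b = 0, b' = 1` at `0`, the values of `G, G', G''` there are `P`, `Q` and
  -- `f(0) P + 2 R`; the initial conditions dictate the three vectors.
  set P : Mink := ![c, c, 0] with hP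
  set Q : Mink := ![c, c, 1] with hQ
  set R : Mink := ![3 / 4 * c, -(1 / 4) * c, 1 / 2] with hR
  have hinn : ∀ α β γ : ℝ, inn (α • P + β • Q + γ • R) (α • P + β • Q + γ • R) =
      β ^ 2 - α * γ := by
    intro α β γ
    simp [inn, hP, hQ, hR]
    linear_combination (-(2 * α * γ) - γ ^ 2 / 2 - 2 * β * γ) * hcc
  set G : ℝ → Mink := fun t => (a t * a t) • P + (a t * b t) • Q + (b t * b t) • R with hG
  set G₁ : ℝ → Mink := fun t => (2 * (a t * a' t)) • P + (a t * b' t + a' t * b t) • Q +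
    (2 * (b t * b' t)) • R with hG₁
  set G₂ : ℝ → Mink := fun t => (2 * (a' t * a' t) + f t * (a t * a t)) • P +
    (2 * (a' t * b' t) + f t * (a t * b t)) • Q +
    (2 * (b' t * b' t) + f t * (b t * b t)) • R with hG₂
  have hGd : ∀ t ∈ I, HasDerivAt G (G₁ t) t := by
    intro t ht
    have h1 := ((ha t ht).mul (ha t ht)).smul_const P
    have h2 := ((ha t ht).mul (hb t ht)).smul_const Q
    have h3 := ((hb t ht).mul (hb t ht)).smul_const R
    refine ((h1.add h2).add h3).congr_deriv ?_
    simp only [hG₁]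
    module
  have hG₁d : ∀ t ∈ I, HasDerivAt G₁ (G₂ t) t := by
    intro t ht
    have h1 := (((ha t ht).mul (ha' t ht)).const_mul 2).smul_const P
    have h2 := (((ha t ht).mul (hb' t ht)).add ((ha' t ht).mul (hb t ht))).smul_const Q
    have h3 := (((hb t ht).mul (hb' t ht)).const_mul 2).smul_const R
    refine ((h1.add h2).add h3).congr_deriv ?_
    simp only [hG₂]
    module
  have e1 : ∀ t ∈ I, deriv G t = G₁ t := fun t ht => (hGd t ht).deriv
  have e2 : ∀ t ∈ I, deriv (deriv G) t = G₂ t := by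
    intro t ht
    have : deriv G =ᶠ[nhds t] G₁ := by
      filter_upwards [hI.mem_nhds ht] with s hs using e1 s hs
    rw [this.deriv_eq, (hG₁d t ht).deriv]
  have hGs : ContDiffOn ℝ ∞ G I :=
    (((has.mul has).smul contDiffOn_const).add ((has.mul hbs).smul contDiffOn_const)).add
      ((hbs.mul hbs).smul contDiffOn_const)
  have hnull : IsNullCurve I G := by
    refine ⟨hGs, fun _ _ => ?_, fun t ht => ?_⟩
    · rw [hG, hinn]; ring
    · rw [e1 t ht, hG₁, hinn]
      linear_combination (a t * b' t - a' t * b t + 1) * hW t ht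
  have hgram : ∀ t ∈ I, inn (deriv (deriv G) t) (deriv (deriv G) t) = -2 * f t := by
    intro t ht
    rw [e2 t ht, hG₂, hinn]
    linear_combination (-2 * f t) * (a t * b' t - a' t * b t + 1) * hW t ht
  refine ⟨G, hnull, ⟨by exact_mod_cast contDiffOn_infty.1 hGs 3, hnull.ode hI hgram, ?_, ?_, ?_⟩, hgram⟩
  · simp [hG, ha0, hb0, hP, hc]
  · rw [e1 0 h0]
    simp [hG₁, ha0, hb0, ha0', hb0', hQ, hc]
  · rw [iteratedDeriv_two_eq, e2 0 h0]
    simp only [hG₂, ha0, hb0, ha0', hb0', hP, hQ, hR]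
    ext i
    fin_cases i <;> simp <;> ring

/-! ### The ruled surface of a null curve -/

namespace IsNullCurve

variable {I : Set ℝ} {G : ℝ → Mink} {c : Mink}

theorem hasFDerivAt_ruled (hG : IsNullCurve I G) (hI : IsOpen I) (hIc : I.OrdConnected)
    (h0 : (0 : ℝ) ∈ I) {q : ℝ × ℝ} (hq : q.2 ∈ I) :
    ∃ L : ℝ × ℝ →L[ℝ] Mink, HasFDerivAt (ruled G c) L q ∧
      ∀ w, L w = (w.1 * Real.exp q.1 - w.2) • G q.2 + (w.2 * Real.exp q.1) • deriv G q.2 := by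
  have h1 : HasFDerivAt (fun q : ℝ × ℝ => Real.exp q.1) _ q := hasFDerivAt_fst.exp
  have h2 : HasFDerivAt (fun q : ℝ × ℝ => G q.2) _ q :=
    (hG.hasDerivAt_zero hI _ hq).hasFDerivAt.comp q hasFDerivAt_snd
  have h3 : HasFDerivAt (fun q : ℝ × ℝ => ∫ τ in (0 : ℝ)..q.2, G τ) _ q :=
    (hasDerivAt_primitive hI hIc hG.smooth.continuousOn h0 hq).hasFDerivAt.comp q hasFDerivAt_snd
  refine ⟨_, ((h1.smul h2).sub h3).sub_const c, fun w => ?_⟩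
  simp
  module

theorem contDiffOn_ruled (hG : IsNullCurve I G) (hI : IsOpen I) (hIc : I.OrdConnected)
    (h0 : (0 : ℝ) ∈ I) : ContDiffOn ℝ ∞ (ruled G c) (Prod.snd ⁻¹' I) := by
  have hsnd : ContDiffOn ℝ ∞ (Prod.snd : ℝ × ℝ → ℝ) (Prod.snd ⁻¹' I) := contDiff_snd.contDiffOn
  have h1 : ContDiffOn ℝ ∞ (fun q : ℝ × ℝ => Real.exp q.1) (Prod.snd ⁻¹' I) :=
    (Real.contDiff_exp.comp contDiff_fst).contDiffOn
  have h2 : ContDiffOn ℝ ∞ (fun v => ∫ τ in (0 : ℝ)..v, G τ) I :=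
    contDiffOn_of_hasDerivAt hI hG.smooth fun t ht =>
      hasDerivAt_primitive hI hIc hG.smooth.continuousOn h0 ht
  exact ((h1.smul (hG.smooth.comp hsnd fun _ h => h)).sub
    (h2.comp hsnd fun _ h => h)).sub contDiffOn_const

theorem fderiv_ruled (hG : IsNullCurve I G) (hI : IsOpen I) (hIc : I.OrdConnected)
    (h0 : (0 : ℝ) ∈ I) {q : ℝ × ℝ} (hq : q.2 ∈ I) (w : ℝ × ℝ) :
    fderiv ℝ (ruled G c) q w =
      (w.1 * Real.exp q.1 - w.2) • G q.2 + (w.2 * Real.exp q.1) • deriv G q.2 := by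
  obtain ⟨L, hL, h⟩ := hG.hasFDerivAt_ruled (c := c) hI hIc h0 hq
  rw [hL.fderiv, h]

theorem gram (hG : IsNullCurve I G) (hI : IsOpen I) {t : ℝ} (ht : t ∈ I) :
    IsGram (-1 / 2 * inn (deriv (deriv G) t) (deriv (deriv G) t)) (G t) (deriv G t)
      (deriv (deriv G) t) :=
  hG.isGram hI ht (by ring)

theorem injective_fderiv_ruled (hG : IsNullCurve I G) (hI : IsOpen I) (hIc : I.OrdConnected)
    (h0 : (0 : ℝ) ∈ I) {q : ℝ × ℝ} (hq : q.2 ∈ I) :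
    Function.Injective (fderiv ℝ (ruled G c) q) := by
  rw [injective_iff_map_eq_zero]
  intro w hw
  rw [hG.fderiv_ruled hI hIc h0 hq] at hw
  have g := hG.gram hI hq
  have he := (Real.exp_pos q.1).ne'
  -- Pairing with `G'` isolates `w.2`, and pairing with `G''` then isolates `w.1`.
  have h1 := congrArg (fun x => inn x (deriv G q.2)) hw
  have h2 := congrArg (fun x => inn x (deriv (deriv G) q.2)) hw
  simp only [inn_add_left, inn_smul_left, g.ab, g.bb, g.ac, g.bc, inn_zero_left] at h1 h2
  have hw2 : w.2 = 0 := by simpa [he] using h1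
  have hw1 : w.1 = 0 := by simpa [he, hw2] using h2
  exact Prod.ext hw1 hw2

theorem mem_tangentPlane_ruled (hG : IsNullCurve I G) (hI : IsOpen I) (hIc : I.OrdConnected)
    (h0 : (0 : ℝ) ∈ I) {q : ℝ × ℝ} (hq : q.2 ∈ I) (α β : ℝ) :
    α • G q.2 + β • deriv G q.2 ∈ tangentPlane (ruled G c) q := by
  have he := (Real.exp_pos q.1).ne'
  refine ⟨((α + β / Real.exp q.1) / Real.exp q.1, β / Real.exp q.1), ?_⟩
  refine (hG.fderiv_ruled hI hIc h0 hq _).trans ?_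
  simp only [div_mul_cancel₀ _ he, add_sub_cancel_right]

theorem inn_eq_zero_of_mem (hG : IsNullCurve I G) (hI : IsOpen I) (hIc : I.OrdConnected)
    (h0 : (0 : ℝ) ∈ I) {q : ℝ × ℝ} (hq : q.2 ∈ I) {x : Mink}
    (hx : x ∈ tangentPlane (ruled G c) q) : inn (G q.2) x = 0 := by
  obtain ⟨w, rfl⟩ := hx
  have g := hG.gram hI hq
  refine (congrArg _ (hG.fderiv_ruled hI hIc h0 hq w)).trans ?_
  simp [inn_add_right, inn_smul_right, g.aa, g.ab]

theorem ne_zero (hG : IsNullCurve I G) (hI : IsOpen I) {t : ℝ} (ht : t ∈ I) : G t ≠ 0 := by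
  intro h
  have := (hG.gram hI ht).ac
  rw [h, inn_zero_left] at this
  norm_num at this

theorem isDegenerate_ruled (hG : IsNullCurve I G) (hI : IsOpen I) (hIc : I.OrdConnected)
    (h0 : (0 : ℝ) ∈ I) {q : ℝ × ℝ} (hq : q.2 ∈ I) :
    IsDegenerate (tangentPlane (ruled G c) q) := by
  refine ⟨G q.2, ?_, hG.ne_zero hI hq, fun w hw => hG.inn_eq_zero_of_mem hI hIc h0 hq hw⟩
  have := hG.mem_tangentPlane_ruled (c := c) hI hIc h0 hq 1 0
  simpa using this

/-- The 1-adapted frame along the ruled surface of a null curve. -/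
noncomputable def frame (G : ℝ → Mink) : Fin 3 → ℝ × ℝ → Mink :=
  ![fun q => Real.exp q.1 • G q.2, fun q => deriv G q.2, fun q => (-Real.exp (-q.1)) •
    (deriv (deriv G) q.2 +
      (1 / 2 * inn (deriv (deriv G) q.2) (deriv (deriv G) q.2)) • G q.2)]

theorem fderiv_frame_zero (hG : IsNullCurve I G) (hI : IsOpen I) {q : ℝ × ℝ} (hq : q.2 ∈ I)
    (w : ℝ × ℝ) : fderiv ℝ (frame G 0) q w =
      (w.1 * Real.exp q.1) • G q.2 + (w.2 * Real.exp q.1) • deriv G q.2 := by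
  have h1 : HasFDerivAt (fun q : ℝ × ℝ => Real.exp q.1) _ q := hasFDerivAt_fst.exp
  have h2 : HasFDerivAt (fun q : ℝ × ℝ => G q.2) _ q :=
    (hG.hasDerivAt_zero hI _ hq).hasFDerivAt.comp q hasFDerivAt_snd
  have h : HasFDerivAt (frame G 0) _ q := h1.smul h2
  rw [h.fderiv]
  simp
  module

/-- Adding `⟨G'', G''⟩ / 2` times `G` makes `G''` null, and the factor `-e^{-u}` normalizes its
product with `e₀ = e^u G`. That `a₁ = 1` is read off from `de₀ - dx = G dv`. -/
theorem isOneAdapted_ruled (hG : IsNullCurve I G) (hI : IsOpen I) (hIc : I.OrdConnected)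
    (h0 : (0 : ℝ) ∈ I) {W : Set (ℝ × ℝ)} (hWo : IsOpen W) (hW : ∀ q ∈ W, q.2 ∈ I) :
    IsOneAdapted W (ruled G c) (frame G) := by
  have hz : IsZeroAdapted W (ruled G c) (frame G) := by
    have hsnd : ContDiffOn ℝ ∞ (Prod.snd : ℝ × ℝ → ℝ) W := contDiff_snd.contDiffOn
    have s0 : ContDiffOn ℝ ∞ (fun q : ℝ × ℝ => G q.2) W := hG.smooth.comp hsnd hW
    have s1 : ContDiffOn ℝ ∞ (fun q : ℝ × ℝ => deriv G q.2) W := (hG.smooth_one hI).comp hsnd hW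
    have s2 : ContDiffOn ℝ ∞ (fun q : ℝ × ℝ => deriv (deriv G) q.2) W :=
      (hG.smooth_two hI).comp hsnd hW
    have e1 : ContDiffOn ℝ ∞ (fun q : ℝ × ℝ => Real.exp q.1) W :=
      (Real.contDiff_exp.comp contDiff_fst).contDiffOn
    have e2 : ContDiffOn ℝ ∞ (fun q : ℝ × ℝ => -Real.exp (-q.1)) W :=
      (Real.contDiff_exp.comp contDiff_fst.neg).neg.contDiffOn
    have f0 : ∀ q, frame G 0 q = Real.exp q.1 • G q.2 := fun _ => rfl
    have f1 : ∀ q, frame G 1 q = deriv G q.2 := fun _ => rfl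
    have f2 : ∀ q, frame G 2 q = (-Real.exp (-q.1)) • (deriv (deriv G) q.2 +
      (1 / 2 * inn (deriv (deriv G) q.2) (deriv (deriv G) q.2)) • G q.2) := fun _ => rfl
    have hexp : ∀ x : ℝ, Real.exp x * Real.exp (-x) = 1 := fun x => by
      rw [← Real.exp_add, add_neg_cancel, Real.exp_zero]
    refine ⟨?_, ?_, ?_, ?_, ?_, ?_, ?_, ?_⟩
    · intro α
      fin_cases α
      · exact e1.smul s0
      · exact s1
      · exact e2.smul (s2.add ((contDiffOn_const.mul (contDiffOn_inn s2 s2)).smul s0))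
    · intro q hq
      apply le_antisymm
      · rw [Submodule.span_le, Set.insert_subset_iff, Set.singleton_subset_iff]
        have h1 := hG.mem_tangentPlane_ruled (c := c) hI hIc h0 (hW q hq) (Real.exp q.1) 0
        have h2 := hG.mem_tangentPlane_ruled (c := c) hI hIc h0 (hW q hq) 0 1
        rw [zero_smul, add_zero] at h1
        rw [zero_smul, zero_add, one_smul] at h2
        exact ⟨h1, h2⟩
      · rintro _ ⟨w, rfl⟩
        refine Submodule.mem_span_pair.2 ⟨(w.1 * Real.exp q.1 - w.2) / Real.exp q.1,
          w.2 * Real.exp q.1, ?_⟩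
        refine Eq.trans ?_ (hG.fderiv_ruled hI hIc h0 (hW q hq) w).symm
        rw [f0, f1, smul_smul, div_mul_cancel₀ _ (Real.exp_pos _).ne']
    all_goals
      intro q hq
      have g := hG.gram hI (hW q hq)
      simp only [f0, f1, f2, inn_smul_left, inn_smul_right, inn_add_left, inn_add_right, g.aa, g.ab,
        g.ac, g.bb, g.bc, inn_comm (deriv G q.2) (G q.2),
        inn_comm (deriv (deriv G) q.2) (G q.2)]
    · ring
    · ring
    · ring
    · ring
    · linear_combination hexp q.1
  refine ⟨hz, fun q hq => (hz.hasA1_iff hWo hq).2 fun w => ⟨w.2 / Real.exp q.1, ?_⟩⟩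
  rw [hG.fderiv_frame_zero hI (hW q hq), hG.fderiv_ruled hI hIc h0 (hW q hq)]
  have : frame G 0 q = Real.exp q.1 • G q.2 := rfl
  rw [this, smul_smul, div_mul_cancel₀ _ (Real.exp_pos _).ne']
  module

theorem isLightlike_image (hG : IsNullCurve I G) (hI : IsOpen I) (hIc : I.OrdConnected)
    (h0 : (0 : ℝ) ∈ I) {W : Set (ℝ × ℝ)} (hW : ∀ q ∈ W, q.2 ∈ I)
    (hY : IsLocalParam (ruled G c '' W) W (ruled G c)) : IsLightlike (ruled G c '' W) := by
  intro U X hX q hq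
  obtain ⟨r, hr, hrq⟩ := hX.mapsTo hq
  have hdeg := hG.isDegenerate_ruled (c := c) hI hIc h0 (hW r hr)
  have hle := hX.tangentPlane_le hY hq hr hrq.symm hdeg
  rw [Submodule.eq_of_le_of_finrank_eq hle
    ((hX.finrank_tangentPlane hq).trans (hY.finrank_tangentPlane hr).symm)]
  exact hdeg

/-- Any frame is compared with the explicit one. The factor relating the null vectors is nonzero,
which settles `a₁`. For a 1-adapted frame, `de₀ - dx = G dv = e^{-u} e₀ dv`, and `ω¹ = e^u ⟨e₁, G'⟩
dv` is nonzero, so `a₂` is the inverse of `e^{2u} ⟨e₁, G'⟩`. -/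
theorem isNonConical_image (hG : IsNullCurve I G) (hI : IsOpen I) (hIc : I.OrdConnected)
    (h0 : (0 : ℝ) ∈ I) {W : Set (ℝ × ℝ)} (hW : ∀ q ∈ W, q.2 ∈ I)
    (hY : IsLocalParam (ruled G c '' W) W (ruled G c)) : IsNonConical (ruled G c '' W) := by
  have hF := hG.isOneAdapted_ruled (c := c) hI hIc h0 hY.isOpen hW
  refine ⟨?_, ?_⟩
  · intro U X E hX hE q hq
    obtain ⟨r, hr, hrq⟩ := hX.mapsTo hq
    refine ⟨_, ?_, hE.hasA1_of_eq hX hY hF.1 hq hr hrq.symm (hF.2 r hr)⟩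
    rw [mul_one]
    exact div_ne_zero (hE.time_ne_zero hq) (hF.1.time_ne_zero hr)
  · intro U X E hX hE q hq
    obtain ⟨r, hr, hrq⟩ := hX.mapsTo hq
    obtain ⟨L, hdX, hdE⟩ := hE.transition hX hY hF hq hr hrq.symm
    have hE0 := hE.eq_of_eq hX hY hF hq hr hrq.symm
    have hf0 : frame G 0 r = Real.exp r.1 • G r.2 := rfl
    have hexp := (Real.exp_pos r.1).ne'
    have h1 : ∀ w, inn (E 1 q) (fderiv ℝ X q w) =
        ((L w).2 * Real.exp r.1) * inn (E 1 q) (deriv G r.2) := by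
      intro w
      have h01 := hE.1.inn_zero_one q hq
      rw [hE0, hf0, inn_smul_left, inn_comm] at h01
      have h01' : inn (E 1 q) (G r.2) = 0 := (mul_eq_zero.1 h01).resolve_left hexp
      rw [hdX, ContinuousLinearMap.comp_apply, hG.fderiv_ruled hI hIc h0 (hW r hr),
        inn_add_right, inn_smul_right, inn_smul_right, h01']
      ring
    have hβ : inn (E 1 q) (deriv G r.2) ≠ 0 := by
      intro h
      obtain ⟨w, hw⟩ := hE.1.exists_inn_one_fderiv hq
      rw [h1, h, mul_zero] at hw
      exact zero_ne_one hw
    refine ⟨(Real.exp r.1 * Real.exp r.1 * inn (E 1 q) (deriv G r.2))⁻¹,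
      inv_ne_zero (mul_ne_zero (mul_ne_zero hexp hexp) hβ), ?_⟩
    rw [hE.hasA2_iff hX.isOpen hq]
    intro w
    rw [h1, hE0, hf0, smul_smul, hdX, hdE, ContinuousLinearMap.comp_apply,
      ContinuousLinearMap.comp_apply, hG.fderiv_ruled hI hIc h0 (hW r hr),
      hG.fderiv_frame_zero hI (hW r hr)]
    have : (Real.exp r.1 * Real.exp r.1 * inn (E 1 q) (deriv G r.2))⁻¹ *
        ((L w).2 * Real.exp r.1 * inn (E 1 q) (deriv G r.2)) * Real.exp r.1 = (L w).2 := by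
      field_simp
    rw [this]
    module

end IsNullCurve

/-! ### Isometric images -/

namespace IsLocalParam

variable {S : Set Mink} {U : Set (ℝ × ℝ)} {X Y : ℝ × ℝ → Mink}

theorem congr (hX : IsLocalParam S U X) (h : Set.EqOn Y X U) : IsLocalParam S U Y where
  isOpen := hX.isOpen
  smooth := hX.smooth.congr h
  immersion q hq := by
    rw [(h.eventuallyEq_of_mem (hX.isOpen.mem_nhds hq)).fderiv_eq]
    exact hX.immersion q hq
  mapsTo := hX.mapsTo.congr h.symm
  isOpenEmbedding := by
    convert! hX.isOpenEmbedding using 1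
    funext q
    exact Subtype.ext (h q.2)

theorem image (hX : IsLocalParam S U X) {A : Matrix (Fin 3) (Fin 3) ℝ} (b : Mink)
    (hA : ∀ v w : Mink, inn (A *ᵥ v) (A *ᵥ w) = inn v w) :
    IsLocalParam ((fun x => A *ᵥ x + b) '' S) U (fun q => A *ᵥ X q + b) := by
  -- A map preserving a nondegenerate form is injective: its kernel is orthogonal to everything.
  have hinj : Function.Injective (Matrix.mulVecLin A) := by
    rw [injective_iff_map_eq_zero]
    intro v hv
    have h : ∀ w, inn v w = 0 := fun w => by
      rw [← hA]
      have : A *ᵥ v = 0 := hv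
      rw [this, inn_zero_left]
    have h0 := h ![1, 0, 0]
    have h1 := h ![0, 1, 0]
    have h2 := h ![0, 0, 1]
    simp [inn] at h0 h1 h2
    ext i
    fin_cases i
    exacts [h0, h1, h2]
  let L : Mink ≃L[ℝ] Mink :=
    (LinearEquiv.ofInjectiveEndo (Matrix.mulVecLin A) hinj).toContinuousLinearEquiv
  let φ : Mink ≃ₜ Mink := L.toHomeomorph.trans (Homeomorph.addRight b)
  refine ⟨hX.isOpen, ?_, ?_, fun q hq => ⟨X q, hX.mapsTo hq, rfl⟩, ?_⟩
  · exact (L.contDiff.comp_contDiffOn hX.smooth).add contDiffOn_const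
  · intro q hq
    have : HasFDerivAt (fun q => A *ᵥ X q + b) ((L : Mink →L[ℝ] Mink).comp (fderiv ℝ X q)) q :=
      (L.hasFDerivAt.comp q (hX.differentiableAt hq).hasFDerivAt).add_const b
    rw [this.fderiv]
    exact L.injective.comp (hX.immersion q hq)
  · exact (φ.image S).isOpenEmbedding.comp hX.isOpenEmbedding

end IsLocalParam

theorem deriv_mulVec {I : Set ℝ} (hI : IsOpen I) (A : Matrix (Fin 3) (Fin 3) ℝ) {g G : ℝ → Mink}
    (hG : DifferentiableOn ℝ G I) (h : ∀ t ∈ I, g t = A *ᵥ G t) :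
    ∀ t ∈ I, deriv g t = A *ᵥ deriv G t := by
  intro t ht
  have h1 : HasDerivAt (fun t => A *ᵥ G t) (A *ᵥ deriv G t) t :=
    (LinearMap.toContinuousLinearMap (Matrix.mulVecLin A)).hasFDerivAt.comp_hasDerivAt t
      ((hG t ht).differentiableAt (hI.mem_nhds ht)).hasDerivAt
  have h2 : g =ᶠ[nhds t] fun t => A *ᵥ G t := by
    filter_upwards [hI.mem_nhds ht] with s hs using h s hs
  rw [h2.deriv_eq, h1.deriv]

/-- The prescribed initial vectors have the Gram matrix forced on every unit-speed null curve, so an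
isometry can move any such curve to these initial conditions. -/
theorem isGram_initial (f : ℝ) : IsGram f ![1 / √2, 1 / √2, 0] ![1 / √2, 1 / √2, 1]
    ![(1 / √2) * (f + 3 / 2), (1 / √2) * (f - 1 / 2), 1] := by
  have hc : (1 / √2 : ℝ) * (1 / √2) = 1 / 2 := by
    rw [div_mul_div_comm, Real.mul_self_sqrt (by norm_num)]; norm_num
  generalize (1 / √2 : ℝ) = c at hc
  constructor <;> simp only [inn, Matrix.cons_val_zero, Matrix.cons_val_one, Matrix.cons_val]
  · ring
  · ring
  · linear_combination (-2) * hc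
  · ring
  · linear_combination (-2) * hc
  · linear_combination (-4 * f - 2) * hc

theorem ruled_mulVec (A : Matrix (Fin 3) (Fin 3) ℝ) {I : Set ℝ} (hIc : I.OrdConnected)
    (h0 : (0 : ℝ) ∈ I) {G : ℝ → Mink} (hG : ContinuousOn G I) (c : Mink) {q : ℝ × ℝ}
    (hq : q.2 ∈ I) :
    ruled (fun t => A *ᵥ G t) (A *ᵥ G 0) q = A *ᵥ ruled G c q + (A *ᵥ c - A *ᵥ G 0) := by
  have h := (LinearMap.toContinuousLinearMap (Matrix.mulVecLin A)).intervalIntegral_comp_comm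
    (μ := MeasureTheory.volume) (hG.mono (hIc.uIcc_subset h0 hq)).intervalIntegrable
  have h' : ∫ τ in (0 : ℝ)..q.2, A *ᵥ G τ = A *ᵥ ∫ τ in (0 : ℝ)..q.2, G τ := h
  rw [ruled, ruled, h', Matrix.mulVec_sub, Matrix.mulVec_sub, Matrix.mulVec_smul]
  abel

/-- The function `f` is `-⟨G'', G''⟩ / 2`, the only free entry of the Gram matrix. The linear part
of the isometry aligns the initial data at `v = 0`; the translation turns the constant `c` into `A
G(0)`. -/
theorem locallyNormalForm_of_isNonConical {S : Set Mink} (hS : IsRegularSurface S)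
    (hl : IsLightlike S) (hnc : IsNonConical S) : LocallyNormalForm S := by
  intro p hp
  obtain ⟨δ, u₀, G, c, W₀, hδ, hG, hW₀o, hW₀, hu₀, hm, hpu⟩ := exists_ruled_nullCurve hS hl hnc hp
  set I := Metric.ball (0 : ℝ) δ with hIdef
  have hI : IsOpen I := Metric.isOpen_ball
  have hIc : I.OrdConnected := (convex_ball 0 δ).ordConnected
  have h0 : (0 : ℝ) ∈ I := Metric.mem_ball_self hδ
  obtain ⟨W, hWW₀, huW, hY⟩ := hS.exists_isLocalParam hl hW₀o
    ((hG.contDiffOn_ruled (c := c) hI hIc h0).mono hW₀)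
    (fun q hq => hG.injective_fderiv_ruled hI hIc h0 (hW₀ q hq)) hm hu₀
    (hG.isDegenerate_ruled hI hIc h0 h0)
  set f : ℝ → ℝ := fun t => -1 / 2 * inn (deriv (deriv G) t) (deriv (deriv G) t) with hf
  have hfp : IsProfile I f :=
    ⟨hI, hIc, h0, contDiffOn_const.mul (contDiffOn_inn (hG.smooth_two hI) (hG.smooth_two hI))⟩
  obtain ⟨A, hA, hA0, hA1, hA2⟩ := (hG.gram hI h0).exists_isometry (isGram_initial (f 0))
  have d1 := deriv_mulVec hI A (g := fun t => A *ᵥ G t) (hG.smooth.differentiableOn (by simp))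
    fun _ _ => rfl
  have d2 := deriv_mulVec hI A ((hG.smooth_one hI).differentiableOn (by simp)) d1
  have d3 := deriv_mulVec hI A ((hG.smooth_two hI).differentiableOn (by simp)) d2
  have hsol : IsSolution I f (fun t => A *ᵥ G t) := by
    refine ⟨?_, fun t ht => ?_, hA0, (d1 0 h0).trans hA1, ?_⟩
    · have h3 : ContDiffOn ℝ 3 G I := by exact_mod_cast contDiffOn_infty.1 hG.smooth 3
      exact (LinearMap.toContinuousLinearMap (Matrix.mulVecLin A)).contDiff.comp_contDiffOn h3
    · have h := hG.ode hI (f := f) (fun t _ => by rw [hf]; ring) t ht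
      rw [iteratedDeriv_three_eq] at h ⊢
      rw [d3 t ht, d1 t ht, ← Matrix.mulVec_smul, ← Matrix.mulVec_smul, ← Matrix.mulVec_sub,
        ← Matrix.mulVec_sub, h, Matrix.mulVec_zero]
    · rw [iteratedDeriv_two_eq]
      exact (d2 0 h0).trans hA2
  have hnf : ∀ q : ℝ × ℝ, q.2 ∈ I → normalForm (fun t => A *ᵥ G t) q =
      A *ᵥ ruled G c q + (A *ᵥ c - A *ᵥ G 0) := fun q hq =>
    ruled_mulVec A hIc h0 hG.smooth.continuousOn c hq
  refine ⟨fun x => A *ᵥ x + (A *ᵥ c - A *ᵥ G 0), ⟨A, _, hA, fun _ => rfl⟩, I, f,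
    fun t => A *ᵥ G t, hfp, hsol.isUniqueSolution hfp, W, u₀, fun q hq => hW₀ q (hWW₀ hq), ?_,
    huW, ?_⟩
  · exact (hY.image _ hA).congr fun q hq => hnf q (hW₀ q (hWW₀ hq))
  · rw [hnf _ h0, hpu]

theorem exists_normalForm_surface {I : Set ℝ} {f : ℝ → ℝ} (hf : IsProfile I f) :
    ∃ G : ℝ → Mink, IsUniqueSolution I f G ∧
      ∀ q : ℝ × ℝ, q.2 ∈ I → ∃ W : Set (ℝ × ℝ), q ∈ W ∧ (∀ r ∈ W, r.2 ∈ I) ∧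
        IsLocalParam (normalForm G '' W) W (normalForm G) ∧
        IsRegularSurface (normalForm G '' W) ∧ IsLightlike (normalForm G '' W) ∧
        IsNonConical (normalForm G '' W) := by
  obtain ⟨G, hG, hsol, -⟩ := exists_solution hf
  refine ⟨G, hsol.isUniqueSolution hf, fun q hq => ?_⟩
  obtain ⟨hI, hIc, h0, -⟩ := hf
  obtain ⟨W, hWI, hqW, hY⟩ := exists_isLocalParam_image (Y := ruled G (G 0))
    (hI.preimage continuous_snd) (hG.contDiffOn_ruled hI hIc h0)
    (fun r hr => hG.injective_fderiv_ruled hI hIc h0 hr) hq (hG.isDegenerate_ruled hI hIc h0 hq)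
  exact ⟨W, hqW, hWI, hY, fun p hp => ⟨W, _, hY, hp⟩, hG.isLightlike_image hI hIc h0 hWI hY,
    hG.isNonConical_image hI hIc h0 hWI hY⟩

end LightlikeSurface

/-- Classification of lightlike surfaces of constant type, the normal form of non-conical ones, and
the fact that every smooth function `f` occurs. -/
theorem theorem1 :
    (∀ S : Set LightlikeSurface.Mink,
      LightlikeSurface.IsRegularSurface S → IsPreconnected S →
      LightlikeSurface.IsLightlike S → LightlikeSurface.IsConstantType S →
        LightlikeSurface.InLightlikePlane S ∨ LightlikeSurface.InLightCone S ∨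
          LightlikeSurface.LocallyNormalForm S) ∧
    (∀ S : Set LightlikeSurface.Mink,
      LightlikeSurface.IsRegularSurface S → LightlikeSurface.IsLightlike S →
      LightlikeSurface.IsNonConical S → LightlikeSurface.LocallyNormalForm S) ∧
    (∀ (I : Set ℝ) (f : ℝ → ℝ), LightlikeSurface.IsProfile I f →
      ∃ G : ℝ → LightlikeSurface.Mink, LightlikeSurface.IsUniqueSolution I f G ∧
        ∀ q : ℝ × ℝ, q.2 ∈ I → ∃ W : Set (ℝ × ℝ), q ∈ W ∧ (∀ r ∈ W, r.2 ∈ I) ∧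
          LightlikeSurface.IsLocalParam (LightlikeSurface.normalForm G '' W) W
            (LightlikeSurface.normalForm G) ∧
          LightlikeSurface.IsRegularSurface (LightlikeSurface.normalForm G '' W) ∧
          LightlikeSurface.IsLightlike (LightlikeSurface.normalForm G '' W) ∧
          LightlikeSurface.IsNonConical (LightlikeSurface.normalForm G '' W)) := by
  refine ⟨fun S hS hc hl ht => ?_, fun S hS hl hnc =>
    LightlikeSurface.locallyNormalForm_of_isNonConical hS hl hnc,
    fun I f hf => LightlikeSurface.exists_normalForm_surface hf⟩
  rcases S.eq_empty_or_nonempty with rfl | hne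
  -- `IsPreconnected` admits the empty set, which lies in every light cone.
  · exact Or.inr (Or.inl ⟨0, fun x hx => hx.elim⟩)
  · rcases ht with h | ⟨h1, h2 | h2⟩
    · exact Or.inl (LightlikeSurface.inLightlikePlane_of_a1Zero hS hc hne hl h)
    · exact Or.inr (Or.inl (LightlikeSurface.inLightCone_of_a2Zero hS hc hne hl h1 h2))
    · exact Or.inr (Or.inr (LightlikeSurface.locallyNormalForm_of_isNonConical hS hl ⟨h1, h2⟩))
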